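/- **Notation.** For $\xi\in\mathbb R^3$ write $\xi=(\xi_1,\xi')$ with $\xi'\in\mathbb R^2$. Let $\mathbb R_+=(0,\infty)$, $\mathbb R^3_\pm=\{\xi\in\mathbb R^3:\pm\xi_1>0\}$. **Vlasov–Poisson problem.** Let $\phi_b>0$ and $f_\infty\in L^1(\mathbb R^3)$, $f_\infty\ge 0$. A pair $(f,\phi)$ is a solution of the stationary Vlasov–Poisson problem with completely absorbing wall ($f_b=\alpha=0$) and electron density $n_e(\phi)=e^{-\phi}$, $$\xi_1\partial_xf+\partial_x\phi\,\partial_{\xi_1}f=0,\qquad \partial_{xx}\phi=\int_{\mathbb R^3}f\,d\xi-e^{-\phi}\qquad(x>0,\ \xi\in\mathbb R^3),$$ $$f(0,\xi)=0\ (\xi_1>0),\quad \phi(0)=\phi_b,\quad \lim_{x\to\infty}f(x,\xi)=f_\infty(\xi),\quad \lim_{x\to\infty}\phi(x)=0,$$ if (i) $f\in L^1_{loc}(\overline{\mathbb R_+}\times\mathbb R^3)\cap C(\overline{\mathbb R_+};L^1(\mathbb R^3))$ and $\phi\in C^1(\overline{\mathbb R_+})\cap C^2(\mathbb R_+)$;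 (ii) $f\ge0$, and either $\partial_x\phi>0$ on $\overline{\mathbb R_+}$ or $\partial_x\phi<0$ on $\overline{\mathbb R_+}$; (iii) $\int_0^\infty\!\int_{\mathbb R^3}f\,(\xi_1\partial_x\psi+\partial_x\phi\,\partial_{\xi_1}\psi)\,d\xi\,dx=0$ for every compactly supported $\psi\in C^1(\overline{\mathbb R_+}\times\mathbb R^3)$ with $\psi(0,\xi)=0$ for $\xi\in\mathbb R^3_-$, and $\lim_{x\to\infty}\|f(x,\cdot)-f_\infty\|_{L^1(\mathbb R^3)}=0$; (iv) the Poisson equation holds classically for $x>0$, $\phi(0)=\phi_b$ and $\lim_{x\to\infty}\phi(x)=0$. **Euler–Poisson problem.** For $u_\infty,\phi_b>0$ consider classical solutions $(\rho,u,\phi)$, continuous on $\overline{\mathbb R_+}$ and with $\phi$ monotone, of $$(\rho u)'=0,\quad uu'=\phi',\quad \phi''=\rho-e^{-\phi}\quad(x>0),$$ $$\inf_{x>0}\rho(x)>0,\quad \phi(0)=\phi_b,\quad \lim_{x\to\infty}(\rho,u,\phi)(x)=(1,-u_\infty,0).$$ **Theorem.** Let $u_\infty>1$ and $\varepsilon_0=(u_\infty-1)/2$.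 There exist constants $\delta_0>0$ and $C_0>0$, depending only on $u_\infty$, such that the following holds for every $\phi_b\in(0,\delta_0)$, every $\varphi\in C_0^\infty(\mathbb R^3)$ with $\varphi\ge0$, $\operatorname{supp}\varphi\subset\{|\xi|<1\}$ and $\int_{\mathbb R^3}\varphi\,d\xi=1$, and every $\varepsilon\in(0,\varepsilon_0)$. The Euler–Poisson problem has a unique monotone solution $(\rho,u,\phi)$; the Vlasov–Poisson problem with $$f_\infty(\xi)=f_{\infty,\varepsilon}(\xi)=\frac1{\varepsilon^3}\,\varphi\!\left(\frac{\xi-(-u_\infty,0,0)}{\varepsilon}\right)$$ has a unique solution $(f_\varepsilon,\phi_\varepsilon)$; the moments $$\rho_\varepsilon(x)=\int_{\mathbb R^3}f_\varepsilon(x,\xi)\,d\xi>0,\qquad u_\varepsilon(x)=\frac1{\rho_\varepsilon(x)}\int_{\mathbb R^3}\xi_1f_\varepsilon(x,\xi)\,d\xi$$ are well defined for all $x\ge 0$; and $$\sup_{x\in\mathbb R_+}|\rho_\varepsilon(x)-\rho(x)|+\sup_{x\in\mathbb R_+}|\rho_\varepsilon u_\varepsilon(x)-\rho u(x)|+\sup_{x\in\mathbb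 R_+}|\phi_\varepsilon(x)-\phi(x)|\le C_0\,\varepsilon.$$ -/

import Mathlib

open Set Filter Topology MeasureTheory
open scoped ENNReal

namespace PlasmaSheath

/-- The velocity space `ℝ³` with its Euclidean norm; `ξ 0` is the component normal to the wall. -/
abbrev Velocity : Type := EuclideanSpace ℝ (Fin 3)

/-- The reflection `(ξ₁, ξ₂, ξ₃) ↦ (-ξ₁, ξ₂, ξ₃)`. -/
def reflect (ξ : Velocity) : Velocity := !₂[-ξ 0, ξ 1, ξ 2]

/-- The derivative on the closed half-line `[0, ∞)` (one-sided at `0`). -/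
noncomputable def dx (φ : ℝ → ℝ) (x : ℝ) : ℝ := derivWithin φ (Ici 0) x

/-- The class of test functions: `C¹` functions with compact support on `[0, ∞) × ℝ³` such that
`α ψ(0, ξ₁, ξ') = ψ(0, -ξ₁, ξ')` for `ξ₁ > 0`. They are given as restrictions of compactly
supported `C¹` functions on `ℝ × ℝ³`, which yields all such functions. -/
structure IsTestFunction (α : ℝ) (ψ : ℝ × Velocity → ℝ) : Prop where
  contDiff : ContDiff ℝ 1 ψ
  hasCompactSupport : HasCompactSupport ψ
  boundary : ∀ ξ : Velocity, 0 < ξ 0 → α * ψ (0, ξ) = ψ (0, reflect ξ)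

/-- The weak form of `ξ₁ ∂ₓf + φ' ∂_{ξ₁}f = 0` on `x > 0` with the boundary condition
`f(0, ξ) = fb(ξ) + α f(0, -ξ₁, ξ')` for `ξ₁ > 0`. -/
def WeakVlasov (fb : Velocity → ℝ) (α : ℝ) (f : ℝ → Velocity → ℝ) (φ : ℝ → ℝ) : Prop :=
  ∀ ψ : ℝ × Velocity → ℝ, IsTestFunction α ψ →
    (∫ z in (Ioi (0 : ℝ)) ×ˢ (univ : Set Velocity),
        f z.1 z.2 * (z.2 0 * fderiv ℝ ψ z (1, 0)
          + dx φ z.1 * fderiv ℝ ψ z (0, EuclideanSpace.single 0 1)))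
      + (∫ ξ in {ξ : Velocity | 0 < ξ 0}, fb ξ * (ξ 0 * ψ (0, ξ))) = 0

/-- Solutions `(f, φ)` of the boundary value problem for the stationary Vlasov--Poisson system on
the half-line: electron density `ne`, boundary source `fb`, reflection rate `α`, boundary
potential `φb`, velocity distribution `finf` at infinity. Only the values for `x ≥ 0` matter, and
`f x` stands for its class in `L¹(ℝ³)`. -/
structure IsVlasovPoissonSolution (ne : ℝ → ℝ) (fb : Velocity → ℝ) (α φb : ℝ)
    (finf : Velocity → ℝ) (f : ℝ → Velocity → ℝ) (φ : ℝ → ℝ) : Prop where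
  /-- `f ∈ L¹_loc([0, ∞) × ℝ³)` -/
  locallyIntegrable :
    LocallyIntegrableOn (fun z : ℝ × Velocity => f z.1 z.2) ((Ici (0 : ℝ)) ×ˢ univ)
  /-- `f ∈ C([0, ∞); L¹(ℝ³))` -/
  integrable : ∀ x, 0 ≤ x → Integrable (f x)
  continuous : ∀ x₀, 0 ≤ x₀ →
    Tendsto (fun x => eLpNorm (fun ξ => f x ξ - f x₀ ξ) 1 volume) (𝓝[Ici 0] x₀) (𝓝 0)
  /-- `φ ∈ C¹([0, ∞)) ∩ C²((0, ∞))` -/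
  contDiffOn_one : ContDiffOn ℝ 1 φ (Ici 0)
  contDiffOn_two : ContDiffOn ℝ 2 φ (Ioi 0)
  nonneg : ∀ x, 0 ≤ x → ∀ᵐ ξ, 0 ≤ f x ξ
  monotone : (∀ x, 0 ≤ x → 0 < dx φ x) ∨ (∀ x, 0 ≤ x → dx φ x < 0)
  vlasov : WeakVlasov fb α f φ
  tendsto_distribution :
    Tendsto (fun x => eLpNorm (fun ξ => f x ξ - finf ξ) 1 volume) atTop (𝓝 0)
  poisson : ∀ x, 0 < x → deriv (deriv φ) x = (∫ ξ, f x ξ) - ne (φ x)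
  boundary_potential : φ 0 = φb
  tendsto_potential : Tendsto φ atTop (𝓝 0)

/-- Monotone classical solutions `(ρ, u, φ)` of the stationary Euler--Poisson system of cold
plasma on the half-line, with Boltzmann electrons. Only the values for `x ≥ 0` matter. -/
structure IsEulerPoissonSolution (uinf φb : ℝ) (ρ u φ : ℝ → ℝ) : Prop where
  continuousOn_density : ContinuousOn ρ (Ici 0)
  continuousOn_velocity : ContinuousOn u (Ici 0)
  continuousOn_potential : ContinuousOn φ (Ici 0)
  contDiffOn_density : ContDiffOn ℝ 1 ρ (Ioi 0)
  contDiffOn_velocity : ContDiffOn ℝ 1 u (Ioi 0)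
  contDiffOn_potential : ContDiffOn ℝ 2 φ (Ioi 0)
  mass : ∀ x, 0 < x → deriv (fun y => ρ y * u y) x = 0
  momentum : ∀ x, 0 < x → u x * deriv u x = deriv φ x
  poisson : ∀ x, 0 < x → deriv (deriv φ) x = ρ x - Real.exp (-φ x)
  /-- `inf ρ > 0` -/
  density_pos : ∃ c : ℝ, 0 < c ∧ ∀ x, 0 < x → c ≤ ρ x
  boundary_potential : φ 0 = φb
  tendsto_density : Tendsto ρ atTop (𝓝 1)
  tendsto_velocity : Tendsto u atTop (𝓝 (-uinf))
  tendsto_potential : Tendsto φ atTop (𝓝 0)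
  monotone : MonotoneOn φ (Ici 0) ∨ AntitoneOn φ (Ici 0)

/-- Smooth nonnegative profiles of unit mass supported in the open unit ball. -/
structure IsMollifier (m : Velocity → ℝ) : Prop where
  contDiff : ContDiff ℝ (⊤ : ℕ∞) m
  hasCompactSupport : HasCompactSupport m
  nonneg : ∀ ξ, 0 ≤ m ξ
  tsupport_subset : tsupport m ⊆ Metric.ball 0 1
  integral_eq_one : ∫ ξ, m ξ = 1

/-- `ε⁻³ m((ξ - (-uinf, 0, 0)) / ε)`, an approximation of the delta mass at `(-uinf, 0, 0)`. -/
noncomputable def approxDelta (m : Velocity → ℝ) (uinf ε : ℝ) (ξ : Velocity) : ℝ :=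
  1 / ε ^ 3 * m ((1 / ε) • (ξ - !₂[-uinf, 0, 0]))

/-- The density `ρ(x) = ∫ f(x, ξ) dξ`. -/
noncomputable def density (f : ℝ → Velocity → ℝ) (x : ℝ) : ℝ := ∫ ξ, f x ξ

/-- The mean velocity `u(x) = ρ(x)⁻¹ ∫ ξ₁ f(x, ξ) dξ`. -/
noncomputable def meanVelocity (f : ℝ → Velocity → ℝ) (x : ℝ) : ℝ :=
  1 / density f x * ∫ ξ : Velocity, ξ 0 * f x ξ

/-- `sup_{x > 0} |g x|`, in `[0, ∞]`. -/
noncomputable def supAbs (g : ℝ → ℝ) : ℝ≥0∞ := ⨆ x ∈ Ioi (0 : ℝ), ENNReal.ofReal |g x|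

end PlasmaSheath

namespace PlasmaSheath

/-! Along characteristics the tangential velocity and the energy `ξ₁² / 2 - φ` are conserved. Ions
enter from infinity with normal velocity below `-a`, where `a > 1`, gain speed as `φ` grows towards
the wall, and never turn back. Hence the distribution at `x` is the `accelerated` beam at potential
`φ x`, and its density is a function of the potential alone: the mean of `speedRatio`, i.e. of `|η₁|
/ √(η₁² + 2s)`. The cold plasma obeys the same law with the single speed `u∞`, so both problems
reduce to `φ'' = N(φ) - exp(-φ)` with `φ(0) = φb` and `φ → 0`.

The Bohm condition enters through slopes. `N` falls with slope at most `κ = 1 / a² < 1`, while for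
small potentials `exp(-s)` falls faster, with slope at least `(1 + κ) / 2`. The force is then
increasing with slope at least `(1 - κ) / 2` (`force_sub_ge`). A first integral gives existence
(`exists_decaying_solution`). The maximum principle gives both uniqueness and stability
(`abs_sub_le_of_poisson`): a perturbation of size `ε` in `N` moves `φ` by at most `ε / ((1 - κ) /
2)`. The densities `N` of the two problems differ by at most `ε` because `speedRatio` is 1-Lipschitz
in the speed. The flux is constant in `x`, and its error is that of the mean normal velocity at
infinity.

The delicate point is that every weak solution `f` is the accelerated beam
(`IsAbsorbedFlow.ae_eq_accelerated`). At energies reaching infinity, the flux of each conserved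
quantity is constant in `x`, hence equal to its value in the prescribed distribution. At lower
energies infinity gives no information: such trajectories start and end at the wall. There a test
function admissible at the absorbing wall, whose transport derivative is a nonnegative function
times `φ'`, forces `f = 0`. -/

/-! ### The scalar equation `φ'' = F(φ)`: decaying solutions and comparison. -/

/-- Separation of variables: the solution is the inverse of the travel time `∫ dr / g(r)`, run
backwards. Mere continuity of `g` suffices, and the bounds on `g` make the travel time a bijection
of `ℝ`. -/
theorem exists_hasDerivAt_of_bounded_speed {g : ℝ → ℝ} (hg : Continuous g) {a b : ℝ} (ha : 0 < a)
    (hag : ∀ r, a ≤ g r) (hgb : ∀ r, g r ≤ b) (y₀ : ℝ) :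
    ∃ y : ℝ → ℝ, y 0 = y₀ ∧ ∀ x, HasDerivAt y (-(g (y x))) x := by
  have hpos : ∀ r, 0 < g r := fun r => ha.trans_le (hag r)
  have hb : 0 < b := (hpos 0).trans_le (hgb 0)
  have hinv : Continuous fun r => (g r)⁻¹ := hg.inv₀ fun r => (hpos r).ne'
  set T : ℝ → ℝ := fun s => ∫ r in y₀..s, (g r)⁻¹
  have hT : ∀ s, HasDerivAt T (g s)⁻¹ s := fun s =>
    intervalIntegral.integral_hasDerivAt_right (hinv.intervalIntegrable _ _)
      hinv.aestronglyMeasurable.stronglyMeasurableAtFilter hinv.continuousAt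
  have hT0 : T y₀ = 0 := intervalIntegral.integral_same
  have hTmono : StrictMono T := strictMono_of_hasDerivAt_pos hT fun s => inv_pos.2 (hpos s)
  have hTc : Continuous T := continuous_iff_continuousAt.2 fun s => (hT s).continuousAt
  have hT2 : Monotone fun s => T s - b⁻¹ * s := by
    refine monotone_of_hasDerivAt_nonneg (f' := fun s => (g s)⁻¹ - b⁻¹ * 1)
      (fun s => (hT s).sub ((hasDerivAt_id s).const_mul _)) fun s => ?_
    have := inv_anti₀ (hpos s) (hgb s)
    simp only [Pi.zero_apply]
    linarith
  have htop : Tendsto T atTop atTop := by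
    refine tendsto_atTop_mono' atTop (f₁ := fun s => b⁻¹ * s + -(b⁻¹ * y₀)) ?_
      (tendsto_atTop_add_const_right _ _ (tendsto_id.const_mul_atTop (inv_pos.2 hb)))
    filter_upwards [eventually_ge_atTop y₀] with s hs
    have := hT2 hs
    simp only [hT0] at this
    linarith
  have hbot : Tendsto T atBot atBot := by
    refine tendsto_atBot_mono' atBot (f₁ := fun s => b⁻¹ * s + -(b⁻¹ * y₀)) ?_
      (tendsto_atBot_add_const_right _ _ (tendsto_id.const_mul_atBot (inv_pos.2 hb)))
    filter_upwards [eventually_le_atBot y₀] with s hs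
    have := hT2 hs
    simp only [hT0] at this
    linarith
  let e := hTmono.orderIsoOfSurjective T (hTc.surjective htop hbot)
  have he : ∀ x, T (e.symm x) = x := fun x => e.apply_symm_apply x
  have hz : ∀ x, HasDerivAt e.symm (g (e.symm x)) x := fun x => by
    have := HasDerivAt.of_local_left_inverse e.symm.continuous.continuousAt (hT (e.symm x))
      (inv_ne_zero (hpos _).ne') (Eventually.of_forall he)
    rwa [inv_inv] at this
  refine ⟨fun x => e.symm (-x), ?_, fun x => ?_⟩
  · apply hTmono.injective
    rw [he, hT0, neg_zero]
  · have := (hz (-x)).comp x (hasDerivAt_neg x)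
    simpa [Function.comp_def] using this

/-- A decaying solution satisfies `φ' = -√(2V(φ))` with `V = ∫₀ F`. The bounds on `F` give `c s² ≤
2V(s) ≤ s²`, so `y = log φ` moves with speed between `√c` and `1`. Thus `φ` exists on all of `ℝ`,
stays positive, and decays at least like `exp(-√c x)`. -/
theorem exists_decaying_solution {F : ℝ → ℝ} {c δ y₀ : ℝ} (hc : 0 < c) (hc1 : c ≤ 1)
    (hy₀ : 0 < y₀) (hδ : y₀ ≤ δ) (hF : ContinuousOn F (Icc 0 δ))
    (hFl : ∀ s ∈ Icc 0 δ, c * s ≤ F s) (hFu : ∀ s ∈ Icc 0 δ, F s ≤ s) :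
    ∃ φ : ℝ → ℝ, ContDiff ℝ 2 φ ∧ φ 0 = y₀ ∧ (∀ x, 0 < φ x) ∧ (∀ x, deriv φ x < 0) ∧
      (∀ x, 0 ≤ x → φ x ≤ y₀) ∧ (∀ x, 0 ≤ x → deriv (deriv φ) x = F (φ x)) ∧
      Tendsto φ atTop (𝓝 0) := by
  have hδ0 : 0 ≤ δ := hy₀.le.trans hδ
  -- `F` is controlled only on `[0, δ]`; `G` continues it with slope one, which keeps `c s ≤ G s ≤
  -- s` for all `s ≥ 0`.
  set p : ℝ → ℝ := fun s => max 0 (min s δ)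
  have hp : Continuous p := by fun_prop
  have hpm : ∀ s, p s ∈ Icc 0 δ := fun s => ⟨le_max_left _ _, max_le hδ0 (min_le_right _ _)⟩
  set G : ℝ → ℝ := fun s => F (p s) + (s - p s)
  have hG : Continuous G := (hF.comp_continuous hp hpm).add (continuous_id.sub hp)
  have hGF : ∀ s ∈ Icc 0 δ, G s = F s := fun s hs => by
    have : p s = s := by simp only [p]; rw [min_eq_left hs.2, max_eq_right hs.1]
    simp only [G, this, sub_self, add_zero]
  have hps : ∀ s, 0 ≤ s → p s ≤ s := fun s hs => max_le hs (min_le_left _ _)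
  have hGl : ∀ s, 0 ≤ s → c * s ≤ G s := fun s hs => by
    have h1 := hFl _ (hpm s)
    have h2 := hps s hs
    simp only [G]
    nlinarith
  have hGu : ∀ s, 0 ≤ s → G s ≤ s := fun s hs => by
    have h1 := hFu _ (hpm s)
    simp only [G]
    linarith
  set V : ℝ → ℝ := fun s => ∫ r in (0 : ℝ)..s, G r
  have hV : ∀ s, HasDerivAt V (G s) s := fun s =>
    intervalIntegral.integral_hasDerivAt_right (hG.intervalIntegrable _ _)
      hG.aestronglyMeasurable.stronglyMeasurableAtFilter hG.continuousAt
  have hVl : ∀ s, 0 ≤ s → c * s ^ 2 ≤ 2 * V s := fun s hs => by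
    have h := intervalIntegral.integral_mono_on hs
      ((by fun_prop : Continuous fun r : ℝ => c * r).intervalIntegrable (μ := volume) 0 s)
      (hG.intervalIntegrable (μ := volume) 0 s) (fun r hr => hGl r hr.1)
    rw [intervalIntegral.integral_const_mul, integral_id] at h
    simp only [V]
    linarith
  have hVu : ∀ s, 0 ≤ s → 2 * V s ≤ s ^ 2 := fun s hs => by
    have h := intervalIntegral.integral_mono_on hs
      (hG.intervalIntegrable (μ := volume) 0 s)
      (continuous_id.intervalIntegrable (μ := volume) 0 s) (fun r hr => hGu r hr.1)
    simp only [id, integral_id] at h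
    simp only [V]
    linarith
  have hVc : Continuous V := continuous_iff_continuousAt.2 fun s => (hV s).continuousAt
  obtain ⟨y, hy0, hy⟩ := exists_hasDerivAt_of_bounded_speed
    (g := fun r => √(2 * V (Real.exp r)) / Real.exp r) (a := √c) (b := 1)
    (((continuous_const.mul (hVc.comp Real.continuous_exp)).sqrt).div Real.continuous_exp
      fun r => (Real.exp_pos r).ne') (Real.sqrt_pos.2 hc)
    (fun r => by
      rw [le_div_iff₀ (Real.exp_pos r)]
      refine Real.le_sqrt_of_sq_le ?_
      rw [mul_pow, Real.sq_sqrt hc.le]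
      exact hVl _ (Real.exp_pos r).le)
    (fun r => by
      rw [div_le_one (Real.exp_pos r)]
      exact Real.sqrt_le_iff.2 ⟨(Real.exp_pos r).le, hVu _ (Real.exp_pos r).le⟩)
    (Real.log y₀)
  have hyl : ∀ x, √c ≤ √(2 * V (Real.exp (y x))) / Real.exp (y x) := fun x => by
    rw [le_div_iff₀ (Real.exp_pos _)]
    refine Real.le_sqrt_of_sq_le ?_
    rw [mul_pow, Real.sq_sqrt hc.le]
    exact hVl _ (Real.exp_pos _).le
  have hVpos : ∀ s, 0 < s → 0 < 2 * V s := fun s hs =>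
    (mul_pos hc (pow_pos hs 2)).trans_le (hVl s hs.le)
  set φ : ℝ → ℝ := fun x => Real.exp (y x)
  have hφpos : ∀ x, 0 < φ x := fun x => Real.exp_pos _
  have hφ : ∀ x, HasDerivAt φ (-√(2 * V (φ x))) x := fun x => by
    have := (hy x).exp
    convert this using 1
    simp only [φ]
    field_simp
  have hdφ : deriv φ = fun x => -√(2 * V (φ x)) := funext fun x => (hφ x).deriv
  have hφ2 : ∀ x, HasDerivAt (deriv φ) (G (φ x)) x := fun x => by
    rw [hdφ]
    have h1 := (((hV (φ x)).comp x (hφ x)).const_mul 2).sqrt (hVpos _ (hφpos x)).ne'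
    have h2 : √(2 * V (φ x)) ≠ 0 := (Real.sqrt_pos.2 (hVpos _ (hφpos x))).ne'
    refine h1.neg.congr_deriv ?_
    show -(2 * (G (φ x) * -√(2 * V (φ x))) / (2 * √(2 * V (φ x)))) = G (φ x)
    field_simp
  have hd2 : deriv (deriv φ) = fun x => G (φ x) := funext fun x => (hφ2 x).deriv
  have hφc : Continuous φ := continuous_iff_continuousAt.2 fun x => (hφ x).continuousAt
  have hφneg : ∀ x, deriv φ x < 0 := fun x => by
    rw [hdφ]
    exact neg_neg_of_pos (Real.sqrt_pos.2 (hVpos _ (hφpos x)))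
  have hφ0 : φ 0 = y₀ := by simp only [φ, hy0, Real.exp_log hy₀]
  have hanti : StrictAnti φ := strictAnti_of_deriv_neg hφneg
  have hle : ∀ x, 0 ≤ x → φ x ≤ y₀ := fun x hx => hφ0 ▸ hanti.antitone hx
  refine ⟨φ, ?_, hφ0, hφpos, hφneg, hle, fun x hx => ?_, ?_⟩
  · have h2 : (2 : WithTop ℕ∞) = 1 + 1 := by norm_num
    rw [h2, contDiff_succ_iff_deriv]
    refine ⟨fun x => (hφ x).differentiableAt, by simp, ?_⟩
    rw [contDiff_one_iff_deriv]
    refine ⟨fun x => (hφ2 x).differentiableAt, ?_⟩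
    rw [hd2]
    exact hG.comp hφc
  · rw [hd2]
    exact hGF _ ⟨(hφpos x).le, (hle x hx).trans hδ⟩
  · refine Real.tendsto_exp_atBot.comp ?_
    have hmono : Antitone fun x => y x + √c * x := by
      refine antitone_of_hasDerivAt_nonpos
        (f' := fun x => -(√(2 * V (Real.exp (y x))) / Real.exp (y x)) + √c * 1)
        (fun x => (hy x).add ((hasDerivAt_id x).const_mul _)) fun x => ?_
      have := hyl x
      show -(√(2 * V (Real.exp (y x))) / Real.exp (y x)) + √c * 1 ≤ 0
      linarith
    refine tendsto_atBot_mono' atTop (f₁ := fun x => -(√c * x) + y 0) ?_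
      (tendsto_atBot_add_const_right _ _
        (tendsto_neg_atTop_atBot.comp (tendsto_id.const_mul_atTop (Real.sqrt_pos.2 hc))))
    filter_upwards [eventually_ge_atTop 0] with x hx
    have := hmono hx
    simp only [mul_zero, add_zero] at this
    linarith

/-- Maximum principle. A positive value would force a positive interior maximum, since the boundary
value and the limit are nonpositive. There the second derivative test also yields a local minimum,
so `v` is locally constant, contradicting `v'' > 0`. -/
theorem nonpos_of_deriv_deriv_pos {v : ℝ → ℝ} (hv : ContinuousOn v (Ici 0)) (hv0 : v 0 ≤ 0)
    {L : ℝ} (hL : L ≤ 0) (hlim : Tendsto v atTop (𝓝 L))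
    (hpos : ∀ x, 0 < x → 0 < v x → 0 < deriv (deriv v) x) :
    ∀ x, 0 ≤ x → v x ≤ 0 := by
  intro x hx
  by_contra! h
  obtain ⟨X, hX⟩ := (hlim.eventually (gt_mem_nhds (hL.trans_lt h))).exists_forall_of_atTop
  have hne : (Icc 0 (max x X)).Nonempty := ⟨x, hx, le_max_left _ _⟩
  obtain ⟨z, hz, hmax⟩ := isCompact_Icc.exists_isMaxOn hne (hv.mono Icc_subset_Ici_self)
  have hxz : v x ≤ v z := hmax ⟨hx, le_max_left _ _⟩
  have hzpos : 0 < v z := h.trans_le hxz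
  have hz0 : 0 < z := lt_of_le_of_ne hz.1 fun h0 => by rw [← h0] at hzpos; linarith
  have hglob : ∀ w, 0 ≤ w → v w ≤ v z := fun w hw => by
    by_cases hwX : w ≤ max x X
    · exact hmax ⟨hw, hwX⟩
    · exact (hX w ((le_max_right _ _).trans (not_le.1 hwX).le)).le.trans hxz
  have hlm : IsLocalMax v z := by
    filter_upwards [Ioi_mem_nhds hz0] with w hw using hglob w (le_of_lt hw)
  have hcz : ContinuousAt v z := hv.continuousAt (Ici_mem_nhds hz0)
  have hlmin := isLocalMin_of_deriv_deriv_pos (hpos z hz0 hzpos) hlm.deriv_eq_zero hcz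
  have hconst : v =ᶠ[𝓝 z] fun _ => v z := by
    filter_upwards [hlm, hlmin] with w h1 h2 using le_antisymm h1 h2
  have h1 : deriv v =ᶠ[𝓝 z] fun _ => 0 := by
    filter_upwards [hconst.deriv] with w hw
    rw [hw, deriv_const]
  have h2 := h1.deriv_eq
  rw [deriv_const] at h2
  exact (hpos z hz0 hzpos).ne' h2

theorem deriv_deriv_sub_sub_const {φ₁ φ₂ : ℝ → ℝ} (h₁ : ContDiffOn ℝ 2 φ₁ (Ioi 0))
    (h₂ : ContDiffOn ℝ 2 φ₂ (Ioi 0)) (k : ℝ) {x : ℝ} (hx : 0 < x) :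
    deriv (deriv fun z => φ₁ z - φ₂ z - k) x = deriv (deriv φ₁) x - deriv (deriv φ₂) x := by
  have hd : ∀ {φ : ℝ → ℝ}, ContDiffOn ℝ 2 φ (Ioi 0) → ∀ z, 0 < z →
      DifferentiableAt ℝ φ z ∧ DifferentiableAt ℝ (deriv φ) z := fun {φ} h z hz =>
    ⟨(h.differentiableOn (by norm_num)).differentiableAt (Ioi_mem_nhds hz),
      ((h.deriv_of_isOpen (m := 1) isOpen_Ioi (by norm_num)).differentiableOn
        (by norm_num)).differentiableAt (Ioi_mem_nhds hz)⟩
  have hev : deriv (fun z => φ₁ z - φ₂ z - k) =ᶠ[𝓝 x] fun z => deriv φ₁ z - deriv φ₂ z := by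
    filter_upwards [Ioi_mem_nhds hx] with z hz
    rw [deriv_sub_const, deriv_fun_sub (hd h₁ z hz).1 (hd h₂ z hz).1]
  rw [hev.deriv_eq, deriv_fun_sub (hd h₁ x hx).2 (hd h₂ x hx).2]

/-- Comparison of two decaying solutions of `φ'' = Fᵢ(φ)` with the same boundary value. -/
theorem abs_sub_le_of_poisson {F₁ F₂ φ₁ φ₂ : ℝ → ℝ} {c δ η : ℝ} (hc : 0 < c) (hη : 0 ≤ η)
    (hF₁ : ∀ s t, 0 ≤ s → s ≤ t → t ≤ δ → c * (t - s) ≤ F₁ t - F₁ s)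
    (hF : ∀ s, 0 ≤ s → s ≤ δ → |F₁ s - F₂ s| ≤ η)
    (hc₁ : ContinuousOn φ₁ (Ici 0)) (hc₂ : ContinuousOn φ₂ (Ici 0))
    (hd₁ : ContDiffOn ℝ 2 φ₁ (Ioi 0)) (hd₂ : ContDiffOn ℝ 2 φ₂ (Ioi 0))
    (hb₁ : ∀ x, 0 ≤ x → φ₁ x ∈ Icc 0 δ) (hb₂ : ∀ x, 0 ≤ x → φ₂ x ∈ Icc 0 δ)
    (h0 : φ₁ 0 = φ₂ 0) (hl₁ : Tendsto φ₁ atTop (𝓝 0)) (hl₂ : Tendsto φ₂ atTop (𝓝 0))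
    (he₁ : ∀ x, 0 < x → deriv (deriv φ₁) x = F₁ (φ₁ x))
    (he₂ : ∀ x, 0 < x → deriv (deriv φ₂) x = F₂ (φ₂ x)) :
    ∀ x, 0 ≤ x → |φ₁ x - φ₂ x| ≤ η / c := by
  have hk : 0 ≤ η / c := div_nonneg hη hc.le
  have hkc : c * (η / c) = η := by field_simp
  intro x hx
  rw [abs_le]
  constructor
  -- Where the difference exceeds `η / c`, its second derivative is at least `c (φ₂ - φ₁) - η > 0`.
  -- The other inequality is symmetric.
  · have := nonpos_of_deriv_deriv_pos (v := fun z => φ₂ z - φ₁ z - η / c) (L := 0 - 0 - η / c)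
      ((hc₂.sub hc₁).sub continuousOn_const) (by simp only [h0]; linarith) (by linarith)
      ((hl₂.sub hl₁).sub tendsto_const_nhds) (fun z hz hvz => by
        rw [deriv_deriv_sub_sub_const hd₂ hd₁ _ hz, he₁ z hz, he₂ z hz]
        have h1 := hF₁ (φ₁ z) (φ₂ z) (hb₁ z hz.le).1 (by linarith) (hb₂ z hz.le).2
        have h2 := (abs_le.1 (hF _ (hb₂ z hz.le).1 (hb₂ z hz.le).2)).2
        nlinarith) x hx
    linarith
  · have := nonpos_of_deriv_deriv_pos (v := fun z => φ₁ z - φ₂ z - η / c) (L := 0 - 0 - η / c)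
      ((hc₁.sub hc₂).sub continuousOn_const) (by simp only [h0]; linarith) (by linarith)
      ((hl₁.sub hl₂).sub tendsto_const_nhds) (fun z hz hvz => by
        rw [deriv_deriv_sub_sub_const hd₁ hd₂ _ hz, he₁ z hz, he₂ z hz]
        have h1 := hF₁ (φ₂ z) (φ₁ z) (hb₂ z hz.le).1 (by linarith) (hb₁ z hz.le).2
        have h2 := (abs_le.1 (hF _ (hb₂ z hz.le).1 (hb₂ z hz.le).2)).1
        nlinarith) x hx
    linarith

/-! ### Beams and the change of variables along trajectories. -/

section

/-- The velocity `ξ` with its normal component replaced by `t`. -/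
noncomputable def setNormal (ξ : Velocity) (t : ℝ) : Velocity :=
  ξ + (t - ξ 0) • EuclideanSpace.single 0 1

@[simp] theorem setNormal_zero (ξ : Velocity) (t : ℝ) : setNormal ξ t 0 = t := by
  simp [setNormal]

@[simp] theorem setNormal_one (ξ : Velocity) (t : ℝ) : setNormal ξ t 1 = ξ 1 := by
  simp [setNormal]

@[simp] theorem setNormal_two (ξ : Velocity) (t : ℝ) : setNormal ξ t 2 = ξ 2 := by
  simp [setNormal]

@[simp] theorem setNormal_setNormal (ξ : Velocity) (s t : ℝ) :
    setNormal (setNormal ξ s) t = setNormal ξ t := by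
  ext i; fin_cases i <;> simp

@[simp] theorem setNormal_self (ξ : Velocity) : setNormal ξ (ξ 0) = ξ := by
  simp [setNormal]

theorem norm_sq_setNormal (ξ : Velocity) (t : ℝ) : ‖setNormal ξ t‖ ^ 2 = ‖ξ‖ ^ 2 - ξ 0 ^ 2 + t ^ 2 := by
  simp only [EuclideanSpace.norm_sq_eq, Fin.sum_univ_three, setNormal_zero, setNormal_one,
    setNormal_two, Real.norm_eq_abs, sq_abs]
  ring

theorem abs_normal_le_norm (ξ : Velocity) : |ξ 0| ≤ ‖ξ‖ := by
  simpa using PiLp.norm_apply_le ξ 0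

theorem continuous_setNormal : Continuous fun z : Velocity × ℝ => setNormal z.1 z.2 := by
  unfold setNormal; fun_prop

theorem _root_.Continuous.setNormal {X : Type*} [TopologicalSpace X] {u : X → Velocity} {t : X → ℝ}
    (hu : Continuous u) (ht : Continuous t) : Continuous fun x => setNormal (u x) (t x) :=
  continuous_setNormal.comp (hu.prodMk ht)

/-- A continuous, compactly supported probability density of ions moving towards the wall with
normal speed greater than `a > 1`. -/
structure IsBeam (a : ℝ) (g : Velocity → ℝ) : Prop where
  continuous : Continuous g
  hasCompactSupport : HasCompactSupport g
  nonneg : ∀ ξ, 0 ≤ g ξ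
  integral_eq_one : ∫ ξ, g ξ = 1
  one_lt : 1 < a
  normal_lt : ∀ ξ, g ξ ≠ 0 → ξ 0 < -a

/-- The distribution at potential `p` of the beam `g` accelerated from potential zero. -/
noncomputable def accelerated (g : Velocity → ℝ) (p : ℝ) (ξ : Velocity) : ℝ :=
  if ξ 0 < 0 then g (setNormal ξ (-√(ξ 0 ^ 2 - 2 * p))) else 0

/-- The velocity at potential `p` of a particle which has velocity `η` at potential zero. -/
noncomputable def accelerate (p : ℝ) (η : Velocity) : Velocity :=
  setNormal η (-√(η 0 ^ 2 + 2 * p))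

/-- The ratio of the normal speeds at potential zero and at potential `s`. -/
noncomputable def speedRatio (t s : ℝ) : ℝ := |t| / √(t ^ 2 + 2 * s)

theorem hasFDerivAt_accelerate {p : ℝ} (hp : 0 ≤ p) {η : Velocity} (hη : η 0 < 0) :
    HasFDerivAt (accelerate p)
      (ContinuousLinearMap.id ℝ Velocity
        + ((speedRatio (η 0) p - 1) • (EuclideanSpace.proj 0 : Velocity →L[ℝ] ℝ)).smulRight
          (EuclideanSpace.single 0 1)) η := by
  have h0 : HasFDerivAt (fun ξ : Velocity => ξ 0) (EuclideanSpace.proj 0 : Velocity →L[ℝ] ℝ) η :=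
    (EuclideanSpace.proj 0 : Velocity →L[ℝ] ℝ).hasFDerivAt
  have hpos : 0 < η 0 ^ 2 + 2 * p := by nlinarith
  have hs : HasDerivAt (fun t : ℝ => -√(t ^ 2 + 2 * p) - t) (speedRatio (η 0) p - 1) (η 0) := by
    have h1 := ((((hasDerivAt_id (η 0)).pow 2).add_const (2 * p)).sqrt hpos.ne').neg.sub
      (hasDerivAt_id (η 0))
    refine h1.congr_deriv ?_
    simp only [speedRatio, abs_of_neg hη, id]
    have : √(η 0 ^ 2 + 2 * p) ≠ 0 := (Real.sqrt_pos.2 hpos).ne'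
    simp only [Pi.pow_apply, id]
    field_simp
    norm_num
    ring
  have h2 := hs.comp_hasFDerivAt η h0
  exact (hasFDerivAt_id η).add (h2.smul_const (EuclideanSpace.single 0 (1 : ℝ)))

/-- The derivative is a transvection along the normal direction, so only the normal stretching
factor contributes. -/
theorem det_fderiv_accelerate (k : ℝ) :
    (ContinuousLinearMap.id ℝ Velocity
        + ((k - 1) • (EuclideanSpace.proj 0 : Velocity →L[ℝ] ℝ)).smulRight
          (EuclideanSpace.single 0 1)).det = k := by
  have h := LinearMap.transvection.det
    (((k - 1) • (EuclideanSpace.proj 0 : Velocity →L[ℝ] ℝ)) : Velocity →L[ℝ] ℝ).toLinearMap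
    (EuclideanSpace.single 0 (1 : ℝ))
  have h1 : (1 : ℝ) + (((k - 1) • (EuclideanSpace.proj 0 : Velocity →L[ℝ] ℝ)) :
      Velocity →L[ℝ] ℝ).toLinearMap (EuclideanSpace.single 0 (1 : ℝ)) = k := by
    simp
  rw [h1] at h
  exact h

theorem accelerate_normal_le {p : ℝ} (hp : 0 ≤ p) (η : Velocity) :
    accelerate p η 0 ≤ η 0 := by
  have : -η 0 ≤ √(η 0 ^ 2 + 2 * p) := Real.le_sqrt_of_sq_le (by nlinarith)
  simp only [accelerate, setNormal_zero]
  linarith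

theorem accelerated_accelerate (g : Velocity → ℝ) {p : ℝ} (hp : 0 ≤ p) {η : Velocity}
    (hη : η 0 < 0) : accelerated g p (accelerate p η) = g η := by
  have h0 := (accelerate_normal_le hp η).trans_lt hη
  rw [accelerated, if_pos h0]
  congr 1
  have : (accelerate p η 0) ^ 2 - 2 * p = (-η 0) ^ 2 := by
    simp only [accelerate, setNormal_zero, neg_sq]
    rw [Real.sq_sqrt (by nlinarith)]
    ring
  rw [this, Real.sqrt_sq (by linarith), neg_neg, accelerate, setNormal_setNormal, setNormal_self]

theorem injOn_accelerate {p : ℝ} (hp : 0 ≤ p) : InjOn (accelerate p) {η | η 0 < 0} := by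
  intro η hη ζ hζ h
  have hη' : η 0 < 0 := hη
  have hζ' : ζ 0 < 0 := hζ
  have h0 : √(η 0 ^ 2 + 2 * p) = √(ζ 0 ^ 2 + 2 * p) := by
    have := congrArg (fun v : Velocity => v 0) h
    simpa [accelerate] using this
  have h1 : η 0 = ζ 0 := by
    rw [Real.sqrt_inj (by nlinarith) (by nlinarith)] at h0
    nlinarith
  have : setNormal (accelerate p η) (η 0) = setNormal (accelerate p ζ) (ζ 0) := by rw [h, h1]
  simpa [accelerate] using this

theorem mem_image_accelerate {p : ℝ} {ξ : Velocity} (hξ : ξ 0 < 0) (h : 2 * p < ξ 0 ^ 2) :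
    ξ ∈ accelerate p '' {η | η 0 < 0} := by
  have h0 : 0 < √(ξ 0 ^ 2 - 2 * p) := Real.sqrt_pos.2 (by linarith)
  refine ⟨setNormal ξ (-√(ξ 0 ^ 2 - 2 * p)), by simpa using h0, ?_⟩
  have : √((-ξ 0) ^ 2) = -ξ 0 := Real.sqrt_sq (by linarith)
  rw [neg_sq] at this
  simp [accelerate, Real.sq_sqrt (by linarith : 0 ≤ ξ 0 ^ 2 - 2 * p), this]

variable {a : ℝ} {g : Velocity → ℝ}

namespace IsBeam

/-- If `ξ₁² ≤ 2p`, the square root takes its default value `0`, and a beam vanishes at zero normal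
velocity. This is why `accelerated` needs no separate case for energies that cannot come from
infinity. -/
theorem accelerated_ne_zero (hg : IsBeam a g) {p : ℝ} {ξ : Velocity} (h : accelerated g p ξ ≠ 0) :
    ξ 0 < 0 ∧ 2 * p < ξ 0 ^ 2 ∧ g (setNormal ξ (-√(ξ 0 ^ 2 - 2 * p))) ≠ 0 := by
  unfold accelerated at h
  split_ifs at h with h0
  · refine ⟨h0, ?_, h⟩
    have h1 := hg.normal_lt _ h
    rw [setNormal_zero] at h1
    have h2 : 0 < √(ξ 0 ^ 2 - 2 * p) := by linarith [hg.one_lt]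
    linarith [Real.sqrt_pos.1 h2]
  · exact absurd rfl h

theorem accelerated_nonneg (hg : IsBeam a g) (p : ℝ) (ξ : Velocity) : 0 ≤ accelerated g p ξ := by
  unfold accelerated
  split_ifs
  exacts [hg.nonneg _, le_rfl]

theorem accelerated_zero (hg : IsBeam a g) : accelerated g 0 = g := by
  funext ξ
  unfold accelerated
  split_ifs with h
  · have : √((-ξ 0) ^ 2) = -ξ 0 := Real.sqrt_sq (by linarith)
    rw [neg_sq] at this
    simp [this]
  · by_contra h1
    linarith [hg.normal_lt ξ (Ne.symm h1), hg.one_lt]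

/-- Integration against an accelerated beam, by the change of variables along trajectories. -/
theorem integral_accelerated_mul (hg : IsBeam a g) {p : ℝ} (hp : 0 ≤ p) (G : Velocity → ℝ) :
    ∫ ξ, accelerated g p ξ * G ξ
      = ∫ η, g η * (speedRatio (η 0) p * G (accelerate p η)) := by
  have hH : MeasurableSet {η : Velocity | η 0 < 0} :=
    measurableSet_lt (by fun_prop) measurable_const
  have h := integral_image_eq_integral_abs_det_fderiv_smul volume hH
    (fun η hη => (hasFDerivAt_accelerate hp hη).hasFDerivWithinAt) (injOn_accelerate hp)
    (fun ξ => accelerated g p ξ * G ξ)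
  simp only [det_fderiv_accelerate] at h
  rw [setIntegral_eq_integral_of_forall_compl_eq_zero] at h
  · rw [h, ← setIntegral_eq_integral_of_forall_compl_eq_zero (s := {η : Velocity | η 0 < 0})
      (f := fun η => g η * (speedRatio (η 0) p * G (accelerate p η)))]
    · refine setIntegral_congr_fun hH fun η hη => ?_
      simp only [accelerated_accelerate g hp hη, smul_eq_mul]
      rw [abs_of_nonneg (by unfold speedRatio; positivity)]
      ring
    · intro η hη
      by_contra h0
      have := hg.normal_lt η (left_ne_zero_of_mul h0)
      exact hη (by simp only [mem_ofPred_eq]; linarith [hg.one_lt])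
  · intro ξ hξ
    by_contra h0
    have := hg.accelerated_ne_zero (left_ne_zero_of_mul h0)
    exact hξ (mem_image_accelerate this.1 this.2.1)

theorem exists_bound (hg : IsBeam a g) : ∃ M, 0 ≤ M ∧ (∀ p ξ, |accelerated g p ξ| ≤ M) := by
  obtain ⟨M, hM⟩ := hg.hasCompactSupport.exists_bound_of_continuous hg.continuous
  have hM0 : 0 ≤ M := (norm_nonneg _).trans (hM 0)
  refine ⟨M, hM0, fun p ξ => ?_⟩
  unfold accelerated
  split_ifs
  · exact hM _
  · simpa using hM0

theorem exists_radius (hg : IsBeam a g) (P : ℝ) :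
    ∃ R, ∀ p ≤ P, ∀ ξ, accelerated g p ξ ≠ 0 → ‖ξ‖ ≤ R := by
  obtain ⟨r, hr⟩ := hg.hasCompactSupport.isCompact.isBounded.exists_norm_le
  refine ⟨√(r ^ 2 + 2 * P), fun p hp ξ h => Real.le_sqrt_of_sq_le ?_⟩
  obtain ⟨-, h1, h2⟩ := hg.accelerated_ne_zero h
  have h3 := hr _ (subset_tsupport _ h2)
  have h4 := pow_le_pow_left₀ (norm_nonneg _) h3 2
  rw [norm_sq_setNormal, neg_sq, Real.sq_sqrt (by linarith)] at h4
  linarith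

theorem measurable_accelerated (hg : IsBeam a g) :
    Measurable fun z : ℝ × Velocity => accelerated g z.1 z.2 := by
  unfold accelerated
  refine Measurable.ite (measurableSet_lt (by fun_prop) measurable_const) ?_ measurable_const
  refine (hg.continuous.comp (Continuous.setNormal continuous_snd ?_)).measurable
  fun_prop

theorem integrable_mul_accelerated (hg : IsBeam a g) (p : ℝ) {G : Velocity → ℝ}
    (hG : Continuous G) : Integrable fun ξ => G ξ * accelerated g p ξ := by
  obtain ⟨M, hM0, hM⟩ := hg.exists_bound
  obtain ⟨R, hR⟩ := hg.exists_radius p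
  obtain ⟨B, hB⟩ := (isCompact_closedBall (0 : Velocity) R).exists_bound_of_continuousOn
    hG.continuousOn
  have hm : Measurable (accelerated g p) := hg.measurable_accelerated.comp measurable_prodMk_left
  have hi : IntegrableOn (fun ξ => G ξ * accelerated g p ξ) (Metric.closedBall 0 R) := by
    refine Measure.integrableOn_of_bounded (M := B * M) measure_closedBall_lt_top.ne
      (hG.measurable.mul hm).aestronglyMeasurable ?_
    filter_upwards [ae_restrict_mem Metric.isClosed_closedBall.measurableSet] with ξ hξ
    rw [norm_mul]
    exact mul_le_mul (hB ξ hξ) (hM p ξ) (norm_nonneg _) ((norm_nonneg _).trans (hB ξ hξ))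
  refine (integrableOn_iff_integrable_of_support_subset fun ξ hξ => ?_).1 hi
  rw [mem_closedBall_zero_iff]
  exact hR p le_rfl ξ (right_ne_zero_of_mul hξ)

theorem integrable_accelerated (hg : IsBeam a g) (p : ℝ) : Integrable (accelerated g p) := by
  simpa using hg.integrable_mul_accelerated p (continuous_const (y := (1 : ℝ)))

/-- Dominated convergence: for fixed `ξ` the accelerated beam is continuous in the potential, and
for potentials at most `p₀ + 1` all supports lie in one ball. -/
theorem tendsto_accelerated (hg : IsBeam a g) {ι : Type*} {l : Filter ι}
    [l.IsCountablyGenerated] {p : ι → ℝ} {p₀ : ℝ} (hp : Tendsto p l (𝓝 p₀)) :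
    Tendsto (fun i => eLpNorm (fun ξ => accelerated g (p i) ξ - accelerated g p₀ ξ) 1 volume) l
      (𝓝 0) := by
  obtain ⟨M, hM0, hM⟩ := hg.exists_bound
  obtain ⟨R, hR⟩ := hg.exists_radius (p₀ + 1)
  have hm : ∀ q, Measurable (accelerated g q) := fun q =>
    hg.measurable_accelerated.comp measurable_prodMk_left
  simp only [eLpNorm_one_eq_lintegral_enorm]
  have h := tendsto_lintegral_filter_of_dominated_convergence (μ := volume) (l := l)
    (F := fun i ξ => ‖accelerated g (p i) ξ - accelerated g p₀ ξ‖ₑ) (f := fun _ => 0)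
    ((Metric.closedBall (0 : Velocity) R).indicator fun _ => ENNReal.ofReal (2 * M))
    (Eventually.of_forall fun i => ((hm _).sub (hm _)).enorm) ?_ ?_ ?_
  · simpa using h
  · filter_upwards [hp.eventually (ge_mem_nhds (by linarith : p₀ < p₀ + 1))] with i hi
    refine Eventually.of_forall fun ξ => ?_
    by_cases hξ : ξ ∈ Metric.closedBall (0 : Velocity) R
    · rw [indicator_of_mem hξ, ← ofReal_norm]
      refine ENNReal.ofReal_le_ofReal ((norm_sub_le _ _).trans ?_)
      rw [two_mul]
      exact add_le_add (hM _ _) (hM _ _)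
    · have h0 : ∀ q ≤ p₀ + 1, accelerated g q ξ = 0 := fun q hq => by
        by_contra h1
        exact hξ (mem_closedBall_zero_iff.2 (hR q hq ξ h1))
      rw [h0 _ hi, h0 _ (by linarith)]
      simp
  · rw [lintegral_indicator Metric.isClosed_closedBall.measurableSet, lintegral_const]
    rw [Measure.restrict_apply_univ]
    exact ENNReal.mul_ne_top ENNReal.ofReal_ne_top measure_closedBall_lt_top.ne
  · refine Eventually.of_forall fun ξ => ?_
    have hc : Continuous fun q => accelerated g q ξ := by
      unfold accelerated
      split_ifs
      · exact hg.continuous.comp (Continuous.setNormal continuous_const (by fun_prop))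
      · exact continuous_const
    have h1 := (hc.tendsto p₀).comp hp
    have h2 := (h1.sub_const (accelerated g p₀ ξ)).enorm
    simpa using h2

end IsBeam

end

/-! ### The weak Vlasov equation and its solution by the accelerated beam. -/

section

/-- The direction `(ξ₁, φ'(x) e₁)` of the characteristics in phase space. -/
noncomputable def direction (φ : ℝ → ℝ) (z : ℝ × Velocity) : ℝ × Velocity :=
  (z.2 0, deriv φ z.1 • EuclideanSpace.single 0 1)

theorem continuous_direction {φ : ℝ → ℝ} (hφ : ContDiff ℝ 1 φ) : Continuous (direction φ) := by
  have := hφ.continuous_deriv le_rfl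
  unfold direction
  fun_prop

theorem continuous_fderiv_direction {φ : ℝ → ℝ} (hφ : ContDiff ℝ 1 φ) {ψ : ℝ × Velocity → ℝ}
    (hψ : ContDiff ℝ 1 ψ) : Continuous fun z => fderiv ℝ ψ z (direction φ z) :=
  (hψ.continuous_fderiv one_ne_zero).clm_apply (continuous_direction hφ)

theorem hasCompactSupport_fderiv_direction (φ : ℝ → ℝ) {ψ : ℝ × Velocity → ℝ}
    (hψ : HasCompactSupport ψ) : HasCompactSupport fun z => fderiv ℝ ψ z (direction φ z) := by
  refine (hψ.fderiv ℝ).mono fun z hz h0 => hz ?_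
  simp only [h0, zero_apply]

theorem fderiv_apply_direction (ψ : ℝ × Velocity → ℝ) (z : ℝ × Velocity) (s q : ℝ) :
    s * fderiv ℝ ψ z (1, 0) + q * fderiv ℝ ψ z (0, EuclideanSpace.single 0 1)
      = fderiv ℝ ψ z (s, q • EuclideanSpace.single 0 1) := by
  rw [← smul_eq_mul, ← smul_eq_mul, ← map_smul, ← map_smul, ← map_add]
  simp

theorem integrableOn_mul_of_locallyIntegrableOn {f : ℝ → Velocity → ℝ}
    (hf : LocallyIntegrableOn (fun z : ℝ × Velocity => f z.1 z.2) (Ici (0 : ℝ) ×ˢ univ))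
    {B : ℝ × Velocity → ℝ} (hB : Continuous B) (hBs : HasCompactSupport B) :
    IntegrableOn (fun z : ℝ × Velocity => f z.1 z.2 * B z) (Ioi (0 : ℝ) ×ˢ univ) := by
  obtain ⟨M, hM⟩ := hBs.exists_bound_of_continuous hB
  have hK : IsCompact (tsupport B ∩ Ici (0 : ℝ) ×ˢ univ) :=
    hBs.isCompact.inter_right (isClosed_Ici.prod isClosed_univ)
  have h1 := hf.integrableOn_compact_subset inter_subset_right hK
  have h2 : IntegrableOn (fun z : ℝ × Velocity => f z.1 z.2 * B z)
      (tsupport B ∩ Ici (0 : ℝ) ×ˢ univ) := by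
    have := Integrable.bdd_mul h1 (f := B) (c := M) hB.aestronglyMeasurable
      (Eventually.of_forall hM)
    simpa only [IntegrableOn, mul_comm] using this
  have h3 : IntegrableOn (fun z : ℝ × Velocity => f z.1 z.2 * B z) (Ici (0 : ℝ) ×ˢ univ) := by
    refine h2.of_forall_sdiff_eq_zero (measurableSet_Ici.prod MeasurableSet.univ) fun z hz => ?_
    rw [image_eq_zero_of_notMem_tsupport fun h => hz.2 ⟨h, hz.1⟩, mul_zero]
  exact h3.mono_set (prod_mono Ioi_subset_Ici_self subset_rfl)

/-- Local integrability justifies Fubini, the source term is zero, and only `x > 0` is seen. The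
potential on the half-line may therefore be replaced by a `C¹` extension to `ℝ`. -/
theorem weakVlasov_iff_of_absorbing {f : ℝ → Velocity → ℝ} {φ φ' : ℝ → ℝ}
    (hf : LocallyIntegrableOn (fun z : ℝ × Velocity => f z.1 z.2) (Ici (0 : ℝ) ×ˢ univ))
    (hφ : ContDiff ℝ 1 φ) (heq : EqOn φ' φ (Ici 0)) :
    WeakVlasov (fun _ => 0) 0 f φ' ↔ ∀ ψ, IsTestFunction 0 ψ →
      ∫ x in Ioi (0 : ℝ), ∫ ξ, f x ξ * fderiv ℝ ψ (x, ξ) (direction φ (x, ξ)) = 0 := by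
  refine forall₂_congr fun ψ hψ => ?_
  have hint := integrableOn_mul_of_locallyIntegrableOn hf
    (continuous_fderiv_direction hφ hψ.contDiff)
    (hasCompactSupport_fderiv_direction φ hψ.hasCompactSupport)
  have h1 : ∫ z in Ioi (0 : ℝ) ×ˢ (univ : Set Velocity),
        f z.1 z.2 * (z.2 0 * fderiv ℝ ψ z (1, 0)
          + dx φ' z.1 * fderiv ℝ ψ z (0, EuclideanSpace.single 0 1))
      = ∫ z in Ioi (0 : ℝ) ×ˢ (univ : Set Velocity),
        f z.1 z.2 * fderiv ℝ ψ z (direction φ z) := by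
    refine setIntegral_congr_fun (measurableSet_Ioi.prod MeasurableSet.univ) fun z hz => ?_
    have hz0 : 0 < z.1 := hz.1
    have : dx φ' z.1 = deriv φ z.1 := by
      rw [dx, derivWithin_congr heq (heq hz0.le), derivWithin_of_mem_nhds (Ici_mem_nhds hz0)]
    simp only [this, fderiv_apply_direction, direction]
  rw [h1, Measure.volume_eq_prod, setIntegral_prod _ (by rwa [← Measure.volume_eq_prod])]
  simp

theorem IsTestFunction.eq_zero_of_normal_neg {ψ : ℝ × Velocity → ℝ} (hψ : IsTestFunction 0 ψ)
    {ξ : Velocity} (hξ : ξ 0 < 0) : ψ (0, ξ) = 0 := by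
  have h := hψ.boundary (reflect ξ) (by simpa [reflect] using hξ)
  have h1 : reflect (reflect ξ) = ξ := by
    ext i; fin_cases i <;> simp [reflect]
  rw [h1, zero_mul] at h
  exact h.symm

namespace IsBeam

variable {a : ℝ} {g : Velocity → ℝ} {φ : ℝ → ℝ}

theorem locallyIntegrable_accelerated (hg : IsBeam a g) (hφ : Continuous φ) :
    LocallyIntegrable fun z : ℝ × Velocity => accelerated g (φ z.1) z.2 := by
  obtain ⟨M, hM0, hM⟩ := hg.exists_bound
  rw [locallyIntegrable_iff]
  intro K hK
  refine Measure.integrableOn_of_bounded (M := M) hK.measure_lt_top.ne ?_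
    (Eventually.of_forall fun z => hM _ _)
  exact (hg.measurable_accelerated.comp
    (by fun_prop : Measurable fun z : ℝ × Velocity => (φ z.1, z.2))).aestronglyMeasurable

/-- In the velocities `η` at potential zero, the Jacobian turns the factor `ξ₁` into `η₁`, and the
integrand becomes `g(η) η₁` times the `x`-derivative of `ψ` along the trajectory of `η`. Integration
in `x` leaves only the wall value of `ψ` at a negative normal velocity, which vanishes. -/
theorem weakVlasov_accelerated (hg : IsBeam a g) (hφ : ContDiff ℝ 1 φ) (hpos : ∀ x, 0 < φ x) :
    WeakVlasov (fun _ => 0) 0 (fun x => accelerated g (φ x)) φ := by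
  rw [weakVlasov_iff_of_absorbing
    ((hg.locallyIntegrable_accelerated hφ.continuous).locallyIntegrableOn _) hφ (eqOn_refl _ _)]
  intro ψ hψ
  have hsq : ∀ x (η : Velocity), 0 < η 0 ^ 2 + 2 * φ x := fun x η => by
    have := hpos x; positivity
  have hsqrt : ∀ x (η : Velocity), √(η 0 ^ 2 + 2 * φ x) ≠ 0 := fun x η =>
    (Real.sqrt_pos.2 (hsq x η)).ne'
  have hφc := hφ.continuous
  have hφ'c := hφ.continuous_deriv le_rfl
  -- The derivative of `ψ` along the trajectory of `η`, parametrised by position rather than by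
  -- time.
  set D : ℝ → Velocity → ℝ := fun x η => fderiv ℝ ψ (x, accelerate (φ x) η)
    (1, -(deriv φ x / √(η 0 ^ 2 + 2 * φ x)) • EuclideanSpace.single 0 1)
  have hacc : Continuous fun z : ℝ × Velocity => accelerate (φ z.1) z.2 :=
    Continuous.setNormal continuous_snd (by fun_prop)
  have hDc : Continuous (Function.uncurry D) := by
    refine ((hψ.contDiff.continuous_fderiv one_ne_zero).comp
      (continuous_fst.prodMk hacc)).clm_apply (continuous_const.prodMk ?_)
    have hq : Continuous fun z : ℝ × Velocity => deriv φ z.1 / √(z.2 0 ^ 2 + 2 * φ z.1) :=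
      Continuous.div (by fun_prop) (by fun_prop) fun z => hsqrt z.1 z.2
    exact hq.neg.smul continuous_const
  have hcurve : ∀ η x, HasDerivAt (fun y => ψ (y, accelerate (φ y) η)) (D x η) x := by
    intro η x
    have h1 : HasDerivAt (fun y => accelerate (φ y) η)
        (-(deriv φ x / √(η 0 ^ 2 + 2 * φ x)) • EuclideanSpace.single 0 (1 : ℝ)) x := by
      have h2 := ((((((hφ.differentiable one_ne_zero) x).hasDerivAt.const_mul 2).const_add
        (η 0 ^ 2)).sqrt (hsq x η).ne').neg.sub_const (η 0)).smul_const
          (EuclideanSpace.single (0 : Fin 3) (1 : ℝ))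
      refine (h2.const_add η).congr_deriv ?_
      congr 1
      have := hsqrt x η
      field_simp
    exact ((hψ.contDiff.differentiable one_ne_zero) _).hasFDerivAt.comp_hasDerivAt x
      ((hasDerivAt_id x).prodMk h1)
  have hconv : ∀ x, ∫ ξ, accelerated g (φ x) ξ * fderiv ℝ ψ (x, ξ) (direction φ (x, ξ))
      = ∫ η, g η * (η 0 * D x η) := fun x => by
    rw [hg.integral_accelerated_mul (hpos x).le
      (fun ξ => fderiv ℝ ψ (x, ξ) (direction φ (x, ξ)))]
    refine integral_congr_ae (Eventually.of_forall fun η => ?_)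
    by_cases h0 : g η = 0
    · simp [h0]
    have hη : η 0 < 0 := by linarith [hg.normal_lt η h0, hg.one_lt]
    have h3 := hsqrt x η
    have hdir : direction φ (x, accelerate (φ x) η) = -√(η 0 ^ 2 + 2 * φ x) •
        (1, -(deriv φ x / √(η 0 ^ 2 + 2 * φ x)) • EuclideanSpace.single 0 (1 : ℝ)) := by
      simp only [direction, accelerate, setNormal_zero, Prod.smul_mk, smul_smul, smul_eq_mul,
        mul_one]
      congr 2
      field_simp
    simp only [hdir, map_smul, speedRatio, abs_of_neg hη, smul_eq_mul, D]
    field_simp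
  simp only [hconv]
  have hcomp : HasCompactSupport (Function.uncurry fun x η => g η * (η 0 * D x η)) := by
    refine HasCompactSupport.of_support_subset_isCompact
      ((hψ.hasCompactSupport.isCompact.image continuous_fst).prod hg.hasCompactSupport.isCompact)
      fun z hz => ⟨?_, subset_tsupport _ (left_ne_zero_of_mul hz)⟩
    have h1 : D z.1 z.2 ≠ 0 := right_ne_zero_of_mul (right_ne_zero_of_mul hz)
    refine ⟨(z.1, accelerate (φ z.1) z.2), support_fderiv_subset ℝ fun h2 => h1 ?_, rfl⟩
    simp only [D, h2, zero_apply]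
  have hcont : Continuous (Function.uncurry fun x η => g η * (η 0 * D x η)) := by
    have hgc : Continuous fun z : ℝ × Velocity => g z.2 := hg.continuous.comp continuous_snd
    exact hgc.mul (Continuous.mul (by fun_prop) hDc)
  rw [integral_integral_swap]
  · refine integral_eq_zero_of_ae (Eventually.of_forall fun η => ?_)
    by_cases h0 : g η = 0
    · simp [h0]
    have hη : η 0 < 0 := by linarith [hg.normal_lt η h0, hg.one_lt]
    simp only [integral_const_mul, Pi.zero_apply]
    have hd : deriv (fun y => ψ (y, accelerate (φ y) η)) = fun x => D x η :=
      funext fun x => (hcurve η x).deriv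
    have h4 := HasCompactSupport.integral_Ioi_deriv_eq
      (f := fun y => ψ (y, accelerate (φ y) η)) ?_ ?_ 0
    · rw [hd] at h4
      rw [h4, hψ.eq_zero_of_normal_neg ((accelerate_normal_le (hpos 0).le η).trans_lt hη)]
      simp
    · rw [contDiff_one_iff_deriv]
      refine ⟨fun x => (hcurve η x).differentiableAt, ?_⟩
      rw [hd]
      exact hDc.comp (continuous_id.prodMk continuous_const)
    · exact HasCompactSupport.of_support_subset_isCompact
        (hψ.hasCompactSupport.isCompact.image continuous_fst)
        fun x hx => ⟨_, subset_tsupport _ hx, rfl⟩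
  · exact (hcont.integrable_of_hasCompactSupport hcomp).mono_measure
      (Measure.prod_mono Measure.restrict_le_self le_rfl)

end IsBeam

end

/-! ### Analytic tools: extension of the potential, pairing limits, du Bois-Reymond. -/

/-- Integrate the derivative after continuing it by its value at `0`. The extension is needed
because test functions built from `φ` must be `C¹` across the wall. -/
theorem exists_contDiff_one_extension {φ : ℝ → ℝ} (hφ : ContDiffOn ℝ 1 φ (Ici 0)) :
    ∃ φ' : ℝ → ℝ, ContDiff ℝ 1 φ' ∧ EqOn φ φ' (Ici 0) ∧ ∀ x, 0 ≤ x → deriv φ' x = dx φ x := by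
  have hq : ContinuousOn (dx φ) (Ici 0) :=
    hφ.continuousOn_derivWithin (uniqueDiffOn_Ici 0) le_rfl
  have hQ : Continuous fun y => dx φ (max y 0) :=
    hq.comp_continuous (by fun_prop) fun y => le_max_right y 0
  set φ' : ℝ → ℝ := fun x => φ 0 + ∫ y in (0 : ℝ)..x, dx φ (max y 0)
  have hd : ∀ x, HasDerivAt φ' (dx φ (max x 0)) x := fun x =>
    (intervalIntegral.integral_hasDerivAt_right (hQ.intervalIntegrable _ _)
      hQ.aestronglyMeasurable.stronglyMeasurableAtFilter hQ.continuousAt).const_add _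
  have hd' : ∀ x, 0 ≤ x → HasDerivAt φ' (dx φ x) x := fun x hx => by
    simpa only [max_eq_left hx] using hd x
  refine ⟨φ', ?_, fun x hx => ?_, fun x hx => (hd' x hx).deriv⟩
  · rw [contDiff_one_iff_deriv]
    refine ⟨fun x => (hd x).differentiableAt, ?_⟩
    rwa [funext fun x => (hd x).deriv]
  · refine eq_of_has_deriv_right_eq (a := 0) (b := x) (f' := dx φ) (fun y hy => ?_)
      (fun y hy => (hd' y hy.1).hasDerivWithinAt) (hφ.continuousOn.mono Icc_subset_Ici_self)
      (fun y hy => (hd' y hy.1).continuousAt.continuousWithinAt) (by simp [φ']) x ⟨hx, le_rfl⟩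
    exact ((hφ.differentiableOn one_ne_zero) y hy.1).hasDerivWithinAt.mono (Ici_subset_Ici.2 hy.1)

theorem tendsto_integral_mul_of_tendsto_eLpNorm {α ι : Type*} [MeasurableSpace α] {μ : Measure α}
    {l : Filter ι} [l.IsCountablyGenerated] {f : ι → α → ℝ} {f₀ : α → ℝ}
    (hf : ∀ᶠ i in l, Integrable (f i) μ) (hf₀ : Integrable f₀ μ)
    (hlim : Tendsto (fun i => eLpNorm (fun ξ => f i ξ - f₀ ξ) 1 μ) l (𝓝 0))
    {B : ι → α → ℝ} {B₀ : α → ℝ} {M : ℝ}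
    (hBm : ∀ᶠ i in l, AEStronglyMeasurable (B i) μ) (hBM : ∀ᶠ i in l, ∀ ξ, |B i ξ| ≤ M)
    (hB : ∀ ξ, Tendsto (fun i => B i ξ) l (𝓝 (B₀ ξ))) :
    Tendsto (fun i => ∫ ξ, f i ξ * B i ξ ∂μ) l (𝓝 (∫ ξ, f₀ ξ * B₀ ξ ∂μ)) := by
  have h1 : Tendsto (fun i => ∫ ξ, f₀ ξ * B i ξ ∂μ) l (𝓝 (∫ ξ, f₀ ξ * B₀ ξ ∂μ)) := by
    refine tendsto_integral_filter_of_dominated_convergence (fun ξ => |f₀ ξ| * M) ?_ ?_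
      (hf₀.abs.mul_const M) (Eventually.of_forall fun ξ => (hB ξ).const_mul _)
    · filter_upwards [hBm] with i hi using hf₀.aestronglyMeasurable.mul hi
    · filter_upwards [hBM] with i hi
      refine Eventually.of_forall fun ξ => ?_
      rw [Real.norm_eq_abs, abs_mul]
      exact mul_le_mul_of_nonneg_left (hi ξ) (abs_nonneg _)
  have h2 : Tendsto (fun i => ∫ ξ, (f i ξ - f₀ ξ) * B i ξ ∂μ) l (𝓝 0) := by
    rw [tendsto_zero_iff_enorm_tendsto_zero]
    have h3 : Tendsto (fun i => ENNReal.ofReal M * eLpNorm (fun ξ => f i ξ - f₀ ξ) 1 μ) l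
        (𝓝 0) := by
      have := ENNReal.Tendsto.const_mul hlim (Or.inr (ENNReal.ofReal_ne_top (r := M)))
      rwa [mul_zero] at this
    refine tendsto_of_tendsto_of_tendsto_of_le_of_le' tendsto_const_nhds h3
      (Eventually.of_forall fun _ => zero_le) ?_
    filter_upwards [hBM] with i hi
    refine (enorm_integral_le_lintegral_enorm _).trans ?_
    rw [eLpNorm_one_eq_lintegral_enorm, ← lintegral_const_mul' _ _ ENNReal.ofReal_ne_top]
    refine lintegral_mono fun ξ => ?_
    rw [enorm_mul, mul_comm]
    gcongr
    rw [← ofReal_norm]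
    exact ENNReal.ofReal_le_ofReal (hi ξ)
  have h4 := h2.add h1
  rw [zero_add] at h4
  refine h4.congr' ?_
  filter_upwards [hf, hBm, hBM] with i hi hm hM
  have hb : ∀ᵐ ξ ∂μ, ‖B i ξ‖ ≤ M := Eventually.of_forall hM
  have h5 := (hi.sub hf₀).mul_bdd hm hb
  simp only [Pi.sub_apply] at h5
  rw [← integral_add h5 (hf₀.mul_bdd hm hb)]
  congr 1
  funext ξ
  ring

/-- Zero mean is what makes the primitive vanish again to the right of the support. -/
theorem exists_contDiff_one_primitive {β : ℝ → ℝ} (hβ : Continuous β) (hβs : HasCompactSupport β)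
    (hβU : tsupport β ⊆ Ioi 0) (hβ0 : ∫ x, β x = 0) :
    ∃ χ : ℝ → ℝ, ContDiff ℝ 1 χ ∧ HasCompactSupport χ ∧ tsupport χ ⊆ Ioi 0 ∧ deriv χ = β := by
  obtain ⟨m, hm, hml⟩ := hβs.isCompact.exists_forall_le' continuousOn_id hβU
  obtain ⟨R, hR⟩ := hβs.isCompact.isBounded.exists_norm_le
  set χ : ℝ → ℝ := fun x => ∫ y in (0 : ℝ)..x, β y
  have hd : ∀ x, HasDerivAt χ (β x) x := fun x =>
    intervalIntegral.integral_hasDerivAt_right (hβ.intervalIntegrable _ _)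
      hβ.aestronglyMeasurable.stronglyMeasurableAtFilter hβ.continuousAt
  have hdχ : deriv χ = β := funext fun x => (hd x).deriv
  have hlow : ∀ x, x < m → χ x = 0 := fun x hx => by
    refine (intervalIntegral.integral_congr (g := fun _ => 0) fun y hy => ?_).trans (by simp)
    refine image_eq_zero_of_notMem_tsupport fun h => ?_
    have h1 : m ≤ y := hml y h
    have h2 : y ≤ max 0 x := hy.2
    exact absurd (h1.trans h2) (not_le.2 (max_lt hm hx))
  have hhigh : ∀ x, R < x → χ x = 0 := fun x hx => by
    by_cases hx0 : x ≤ 0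
    · exact hlow x (hx0.trans_lt hm)
    rw [← hβ0]
    simp only [χ]
    rw [intervalIntegral.integral_of_le (not_le.1 hx0).le]
    refine setIntegral_eq_integral_of_forall_compl_eq_zero fun y hy => ?_
    refine image_eq_zero_of_notMem_tsupport fun h => hy ⟨hβU h, ?_⟩
    exact (le_abs_self y).trans ((hR y h).trans hx.le)
  have hsub : Function.support χ ⊆ Icc m R := fun x hx =>
    ⟨not_lt.1 fun h => hx (hlow x h), not_lt.1 fun h => hx (hhigh x h)⟩
  refine ⟨χ, ?_, HasCompactSupport.of_support_subset_isCompact isCompact_Icc hsub, fun x hx =>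
    hm.trans_le (closure_minimal hsub isClosed_Icc hx).1, hdχ⟩
  rw [contDiff_one_iff_deriv, hdχ]
  exact ⟨fun x => (hd x).differentiableAt, hβ⟩

/-- The du Bois-Reymond lemma on the half-line, with the constant identified at infinity. -/
theorem eq_of_forall_integral_deriv_mul_eq_zero {G : ℝ → ℝ} {L : ℝ} (hG : ContinuousOn G (Ioi 0))
    (hL : Tendsto G atTop (𝓝 L))
    (h : ∀ χ : ℝ → ℝ, ContDiff ℝ 1 χ → HasCompactSupport χ → tsupport χ ⊆ Ioi 0 →
      ∫ x in Ioi (0 : ℝ), deriv χ x * G x = 0) :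
    ∀ x, 0 < x → G x = L := by
  have hloc : LocallyIntegrableOn G (Ioi 0) := hG.locallyIntegrableOn measurableSet_Ioi
  have hmul : ∀ b : ℝ → ℝ, Continuous b → HasCompactSupport b → tsupport b ⊆ Ioi 0 →
      IntegrableOn (fun x => b x * G x) (Ioi 0) := fun b hb hbs hbU => by
    have h1 : IntegrableOn (fun x => b x * G x) (tsupport b) :=
      (hb.continuousOn.mul (hG.mono hbU)).integrableOn_compact hbs.isCompact
    exact h1.of_forall_sdiff_eq_zero measurableSet_Ioi fun x hx => by
      rw [image_eq_zero_of_notMem_tsupport hx.2, zero_mul]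
  -- Any unit-mass bump supported in `x > 0` would do; this one lives on `[1, 3]`.
  let B : ContDiffBump (2 : ℝ) := ⟨1 / 2, 1, by norm_num, by norm_num⟩
  set b₀ : ℝ → ℝ := B.normed volume
  have hb₀c : Continuous b₀ := B.continuous_normed
  have hb₀s : HasCompactSupport b₀ := B.hasCompactSupport_normed
  have hb₀U : tsupport b₀ ⊆ Ioi 0 := by
    rw [B.tsupport_normed_eq, Real.closedBall_eq_Icc]
    intro x hx
    have h1 : (2 : ℝ) - 1 ≤ x := hx.1
    simp only [mem_Ioi]
    linarith
  set c : ℝ := ∫ x in Ioi (0 : ℝ), b₀ x * G x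
  have hae : ∀ᵐ x, x ∈ Ioi (0 : ℝ) → G x - c = 0 := by
    refine isOpen_Ioi.ae_eq_zero_of_integral_contDiff_smul_eq_zero
      (hloc.sub (locallyIntegrableOn_const c)) fun b hb hbs hbU => ?_
    have hbc := hb.continuous
    -- Removing the mean makes `β` the derivative of an admissible `χ`; testing with `χ` then says
    -- that `G - c` is orthogonal to `b`.
    set β : ℝ → ℝ := fun x => b x - (∫ y, b y) * b₀ x
    have hβc : Continuous β := by fun_prop
    have hsub : tsupport β ⊆ tsupport b ∪ tsupport b₀ := by
      refine closure_minimal (fun x hx => ?_) ((isClosed_tsupport _).union (isClosed_tsupport _))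
      by_contra hx'
      rw [mem_union, not_or] at hx'
      refine hx ?_
      simp only [β, image_eq_zero_of_notMem_tsupport hx'.1,
        image_eq_zero_of_notMem_tsupport hx'.2, mul_zero, sub_zero]
    have hβU : tsupport β ⊆ Ioi 0 := hsub.trans (union_subset hbU hb₀U)
    have hβs : HasCompactSupport β :=
      (hbs.isCompact.union hb₀s.isCompact).of_isClosed_subset (isClosed_tsupport _) hsub
    have hβ0 : ∫ x, β x = 0 := by
      simp only [β]
      rw [integral_sub (hbc.integrable_of_hasCompactSupport hbs)
        ((hb₀c.integrable_of_hasCompactSupport hb₀s).const_mul _), integral_const_mul,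
        B.integral_normed, mul_one, sub_self]
    obtain ⟨χ, h1, h2, h3, h4⟩ := exists_contDiff_one_primitive hβc hβs hβU hβ0
    have h5 := h χ h1 h2 h3
    rw [h4] at h5
    have h6 : ∫ x in Ioi (0 : ℝ), β x * G x
        = (∫ x in Ioi (0 : ℝ), b x * G x) - (∫ y, b y) * c := by
      rw [← integral_const_mul, ← integral_sub (hmul b hbc hbs hbU)
        ((hmul b₀ hb₀c hb₀s hb₀U).const_mul _)]
      congr 1
      funext x
      simp only [β]
      ring
    have hb0 : ∀ x, x ∉ Ioi (0 : ℝ) → b x = 0 := fun x hx =>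
      image_eq_zero_of_notMem_tsupport fun h => hx (hbU h)
    rw [← setIntegral_eq_integral_of_forall_compl_eq_zero (s := Ioi (0 : ℝ))
      (fun x hx => by rw [hb0 x hx, zero_smul])]
    simp only [smul_eq_mul, mul_sub]
    rw [integral_sub (hmul b hbc hbs hbU)
      ((hbc.integrable_of_hasCompactSupport hbs).integrableOn.mul_const _), integral_mul_const,
      setIntegral_eq_integral_of_forall_compl_eq_zero (fun x hx => hb0 x hx), ← h6, h5]
  have heq : EqOn G (fun _ => c) (Ioi 0) := by
    refine Measure.eqOn_open_of_ae_eq (μ := volume) ?_ isOpen_Ioi hG continuousOn_const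
    rw [EventuallyEq, ae_restrict_iff' measurableSet_Ioi]
    filter_upwards [hae] with x hx hx0 using sub_eq_zero.1 (hx hx0)
  have hLc : L = c := by
    refine tendsto_nhds_unique hL (tendsto_const_nhds.congr' ?_)
    filter_upwards [eventually_gt_atTop 0] with x hx using (heq hx).symm
  intro x hx
  rw [hLc]
  exact heq hx

/-- Used to discard the two velocities `ξ₁ = ±√(2φ)` separating passing from reflected particles. -/
theorem volume_normal_eq (c : ℝ) : volume {ξ : Velocity | ξ 0 = c} = 0 := by
  have h := (EuclideanSpace.volume_preserving_symm_measurableEquiv_toLp (Fin 3)).measure_preimage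
    (s := {y : Fin 3 → ℝ | y 0 = c})
    (measurableSet_eq_fun (by fun_prop) measurable_const).nullMeasurableSet
  have h1 := Measure.pi_hyperplane (fun _ : Fin 3 => (volume : Measure ℝ)) 0 c
  rw [← volume_pi] at h1
  rw [h1] at h
  exact h

/-! ### Conserved quantities and test functions built from them. -/

section

/-- The velocity with the normal component replaced by the energy `ξ₁² / 2 - φ(x)`; it is constant
along characteristics. -/
noncomputable def energyCoord (φ : ℝ → ℝ) (z : ℝ × Velocity) : Velocity :=
  setNormal z.2 (z.2 0 ^ 2 / 2 - φ z.1)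

@[simp] theorem energyCoord_zero (φ : ℝ → ℝ) (z : ℝ × Velocity) :
    energyCoord φ z 0 = z.2 0 ^ 2 / 2 - φ z.1 := setNormal_zero _ _

variable {φ : ℝ → ℝ}

theorem contDiff_energyCoord (hφ : ContDiff ℝ 1 φ) : ContDiff ℝ 1 (energyCoord φ) := by
  unfold energyCoord setNormal
  fun_prop

/-- Along `(ξ₁, φ' e₁)` the energy changes at the rate `ξ₁ φ' - φ' ξ₁ = 0`. -/
theorem fderiv_energyCoord_direction (hφ : ContDiff ℝ 1 φ) (z : ℝ × Velocity) :
    fderiv ℝ (energyCoord φ) z (direction φ z) = 0 := by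
  have hn : HasFDerivAt (fun z : ℝ × Velocity => z.2 0)
      ((EuclideanSpace.proj 0 : Velocity →L[ℝ] ℝ).comp (ContinuousLinearMap.snd ℝ ℝ Velocity)) z :=
    ((EuclideanSpace.proj 0 : Velocity →L[ℝ] ℝ).comp
      (ContinuousLinearMap.snd ℝ ℝ Velocity)).hasFDerivAt
  have hφz : HasFDerivAt (fun z : ℝ × Velocity => φ z.1)
      (deriv φ z.1 • ContinuousLinearMap.fst ℝ ℝ Velocity) z :=
    ((hφ.differentiable one_ne_zero) z.1).hasDerivAt.comp_hasFDerivAt z hasFDerivAt_fst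
  have hsq : HasFDerivAt (fun z : ℝ × Velocity => z.2 0 ^ 2 / 2) (z.2 0 •
      ((EuclideanSpace.proj 0 : Velocity →L[ℝ] ℝ).comp (ContinuousLinearMap.snd ℝ ℝ Velocity)))
      z := by
    have h1 : HasDerivAt (fun t : ℝ => t ^ 2 / 2) (z.2 0) (z.2 0) := by
      have := ((hasDerivAt_id (z.2 0)).pow 2).div_const 2
      refine this.congr_deriv ?_
      simp
    exact h1.comp_hasFDerivAt z hn
  have h := (hasFDerivAt_snd (𝕜 := ℝ) (p := z)).add
    (((hsq.sub hφz).sub hn).smul_const (EuclideanSpace.single (0 : Fin 3) (1 : ℝ)))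
  have h' : HasFDerivAt (energyCoord φ) _ z := h
  rw [h'.fderiv]
  simp [direction]
  rw [← add_smul]
  ring_nf
  simp

/-- A test function on phase space: a function of `x`, times a function of the conserved
quantities, times a function of the normal velocity. -/
noncomputable def phaseTest (φ χ : ℝ → ℝ) (h : Velocity → ℝ) (θ : ℝ → ℝ) (z : ℝ × Velocity) : ℝ :=
  χ z.1 * (h (energyCoord φ z) * θ (z.2 0))

variable {χ θ κ : ℝ → ℝ} {h : Velocity → ℝ}

theorem contDiff_phaseTest (hφ : ContDiff ℝ 1 φ) (hχ : ContDiff ℝ 1 χ) (hh : ContDiff ℝ 1 h)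
    (hθ : ContDiff ℝ 1 θ) : ContDiff ℝ 1 (phaseTest φ χ h θ) := by
  have := contDiff_energyCoord hφ
  unfold phaseTest
  fun_prop

/-- Transport acts only on `χ` and `θ`, since the factor containing `h` is conserved. -/
theorem fderiv_phaseTest_direction (hφ : ContDiff ℝ 1 φ) (hχ : ContDiff ℝ 1 χ)
    (hh : ContDiff ℝ 1 h) (hθ : ContDiff ℝ 1 θ) (z : ℝ × Velocity) :
    fderiv ℝ (phaseTest φ χ h θ) z (direction φ z)
      = deriv χ z.1 * (h (energyCoord φ z) * (z.2 0 * θ (z.2 0)))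
        + χ z.1 * (h (energyCoord φ z) * (deriv θ (z.2 0) * deriv φ z.1)) := by
  have h1 : HasFDerivAt (fun z : ℝ × Velocity => χ z.1)
      (deriv χ z.1 • ContinuousLinearMap.fst ℝ ℝ Velocity) z :=
    ((hχ.differentiable one_ne_zero) z.1).hasDerivAt.comp_hasFDerivAt z hasFDerivAt_fst
  have h2 : HasFDerivAt (fun z => h (energyCoord φ z))
      ((fderiv ℝ h (energyCoord φ z)).comp (fderiv ℝ (energyCoord φ) z)) z :=
    ((hh.differentiable one_ne_zero) _).hasFDerivAt.comp z
      (((contDiff_energyCoord hφ).differentiable one_ne_zero) z).hasFDerivAt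
  have hn : HasFDerivAt (fun z : ℝ × Velocity => z.2 0)
      ((EuclideanSpace.proj 0 : Velocity →L[ℝ] ℝ).comp (ContinuousLinearMap.snd ℝ ℝ Velocity)) z :=
    ((EuclideanSpace.proj 0 : Velocity →L[ℝ] ℝ).comp
      (ContinuousLinearMap.snd ℝ ℝ Velocity)).hasFDerivAt
  have h3 := ((hθ.differentiable one_ne_zero) (z.2 0)).hasDerivAt.comp_hasFDerivAt z hn
  have h4 : HasFDerivAt (phaseTest φ χ h θ) _ z := h1.mul (h2.mul h3)
  rw [h4.fderiv]
  simp only [add_apply, smul_apply, ContinuousLinearMap.comp_apply, fderiv_energyCoord_direction hφ,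
    map_zero, smul_eq_mul]
  simp [direction]
  ring

theorem normal_sq_le_of_energyCoord (x : ℝ) (ξ : Velocity) {R Φ : ℝ}
    (hR : ‖energyCoord φ (x, ξ)‖ ≤ R) (hΦ : φ x ≤ Φ) :
    ξ 0 ^ 2 ≤ 2 * (R + Φ) ∧ ‖ξ‖ ^ 2 ≤ R ^ 2 + 2 * (R + Φ) := by
  have h1 : ξ 0 ^ 2 / 2 - φ x ≤ R := by
    have := (le_abs_self _).trans ((abs_normal_le_norm (energyCoord φ (x, ξ))).trans hR)
    rwa [energyCoord_zero] at this
  have h2 : ‖setNormal ξ (ξ 0 ^ 2 / 2 - φ x)‖ ^ 2 ≤ R ^ 2 :=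
    pow_le_pow_left₀ (norm_nonneg _) hR 2
  rw [norm_sq_setNormal] at h2
  constructor
  · linarith
  · nlinarith [sq_nonneg (ξ 0 ^ 2 / 2 - φ x)]

theorem hasCompactSupport_phaseTest (hφ : Continuous φ) (hχ : HasCompactSupport χ)
    (hh : HasCompactSupport h) (θ : ℝ → ℝ) : HasCompactSupport (phaseTest φ χ h θ) := by
  obtain ⟨R, hR⟩ := hh.isCompact.isBounded.exists_norm_le
  obtain ⟨Φ, hΦ⟩ := hχ.isCompact.exists_bound_of_continuousOn hφ.continuousOn
  refine HasCompactSupport.of_support_subset_isCompact (hχ.isCompact.prod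
    (isCompact_closedBall (0 : Velocity) (√(R ^ 2 + 2 * (R + Φ))))) fun z hz => ?_
  have h1 : z.1 ∈ tsupport χ := subset_tsupport _ (left_ne_zero_of_mul hz)
  have h2 : h (energyCoord φ z) ≠ 0 := left_ne_zero_of_mul (right_ne_zero_of_mul hz)
  refine ⟨h1, mem_closedBall_zero_iff.2 (Real.le_sqrt_of_sq_le ?_)⟩
  exact (normal_sq_le_of_energyCoord z.1 z.2 (hR _ (subset_tsupport _ h2))
    ((le_abs_self _).trans (hΦ _ h1))).2

theorem exists_bound_energyCoord_mul (hh : Continuous h) (hhs : HasCompactSupport h)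
    (hκ : Continuous κ) {Φ : ℝ} (hΦ : ∀ x, 0 ≤ x → φ x ≤ Φ) :
    ∃ M, ∀ x, 0 ≤ x → ∀ ξ : Velocity, |h (energyCoord φ (x, ξ)) * κ (ξ 0)| ≤ M := by
  obtain ⟨R, hR⟩ := hhs.isCompact.isBounded.exists_norm_le
  obtain ⟨M₁, hM₁⟩ := hhs.exists_bound_of_continuous hh
  obtain ⟨M₂, hM₂⟩ := (isCompact_Icc (a := -√(2 * (R + Φ)))
    (b := √(2 * (R + Φ)))).exists_bound_of_continuousOn hκ.continuousOn
  have hM₁0 : 0 ≤ M₁ := (norm_nonneg _).trans (hM₁ 0)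
  have hM₂0 : 0 ≤ M₂ := (norm_nonneg _).trans (hM₂ 0 ⟨by simp, by simp⟩)
  refine ⟨M₁ * M₂, fun x hx ξ => ?_⟩
  by_cases h0 : h (energyCoord φ (x, ξ)) = 0
  · simp only [h0, zero_mul, abs_zero]
    positivity
  have h1 := (normal_sq_le_of_energyCoord x ξ (hR _ (subset_tsupport _ h0)) (hΦ x hx)).1
  rw [abs_mul]
  exact mul_le_mul (hM₁ _) (hM₂ _ (abs_le.1 (Real.abs_le_sqrt h1))) (abs_nonneg _) hM₁0

end

/-! ### Weak solutions at energies that reach infinity. -/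

section

/-- A weak solution `f` of the Vlasov equation with completely absorbing wall, in the field of a
decreasing potential `φ` that vanishes at infinity; here `φ` is extended to `ℝ`. -/
structure IsAbsorbedFlow (g : Velocity → ℝ) (f : ℝ → Velocity → ℝ) (φ : ℝ → ℝ) : Prop where
  contDiff : ContDiff ℝ 1 φ
  deriv_neg : ∀ x, 0 ≤ x → deriv φ x < 0
  tendsto_potential : Tendsto φ atTop (𝓝 0)
  locallyIntegrable :
    LocallyIntegrableOn (fun z : ℝ × Velocity => f z.1 z.2) ((Ici (0 : ℝ)) ×ˢ univ)
  integrable : ∀ x, 0 ≤ x → Integrable (f x)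
  continuous : ∀ x₀, 0 ≤ x₀ →
    Tendsto (fun x => eLpNorm (fun ξ => f x ξ - f x₀ ξ) 1 volume) (𝓝[Ici 0] x₀) (𝓝 0)
  nonneg : ∀ x, 0 ≤ x → ∀ᵐ ξ, 0 ≤ f x ξ
  vlasov : ∀ ψ, IsTestFunction 0 ψ →
    ∫ x in Ioi (0 : ℝ), ∫ ξ, f x ξ * fderiv ℝ ψ (x, ξ) (direction φ (x, ξ)) = 0
  tendsto_distribution :
    Tendsto (fun x => eLpNorm (fun ξ => f x ξ - g ξ) 1 volume) atTop (𝓝 0)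

theorem normal_sq_le_norm_sq (ξ : Velocity) : ξ 0 ^ 2 ≤ ‖ξ‖ ^ 2 := by
  rw [← sq_abs (ξ 0)]
  exact pow_le_pow_left₀ (abs_nonneg _) (abs_normal_le_norm ξ) 2

namespace IsAbsorbedFlow

variable {a : ℝ} {g h : Velocity → ℝ} {f : ℝ → Velocity → ℝ} {φ θ κ : ℝ → ℝ}

theorem strictAntiOn (H : IsAbsorbedFlow g f φ) : StrictAntiOn φ (Ici 0) :=
  strictAntiOn_of_deriv_neg (convex_Ici 0) H.contDiff.continuous.continuousOn fun x hx => by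
    rw [interior_Ici] at hx
    exact H.deriv_neg x (le_of_lt hx)

theorem potential_pos (H : IsAbsorbedFlow g f φ) {x : ℝ} (hx : 0 ≤ x) : 0 < φ x := by
  have h1 : φ (x + 1) < φ x := H.strictAntiOn hx (by simp; linarith) (by linarith)
  have h2 : 0 ≤ φ (x + 1) := by
    refine le_of_tendsto H.tendsto_potential ?_
    filter_upwards [eventually_ge_atTop (x + 1)] with y hy
    exact H.strictAntiOn.antitoneOn (by simp; linarith) (by simp; linarith) hy
  linarith

theorem potential_le (H : IsAbsorbedFlow g f φ) {x : ℝ} (hx : 0 ≤ x) : φ x ≤ φ 0 :=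
  H.strictAntiOn.antitoneOn self_mem_Ici hx hx

theorem continuous_pairing (H : IsAbsorbedFlow g f φ) (hh : Continuous h) (hκ : Continuous κ) :
    Continuous fun z : ℝ × Velocity => h (energyCoord φ z) * κ (z.2 0) := by
  have := (contDiff_energyCoord H.contDiff).continuous
  fun_prop

theorem continuousOn_pairing (H : IsAbsorbedFlow g f φ) (hh : Continuous h)
    (hhs : HasCompactSupport h) (hκ : Continuous κ) :
    ContinuousOn (fun x => ∫ ξ, f x ξ * (h (energyCoord φ (x, ξ)) * κ (ξ 0))) (Ici 0) := by
  intro x₀ hx₀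
  obtain ⟨M, hM⟩ := exists_bound_energyCoord_mul hh hhs hκ fun x hx => H.potential_le hx
  have hc := H.continuous_pairing hh hκ
  refine tendsto_integral_mul_of_tendsto_eLpNorm (M := M) ?_ (H.integrable x₀ hx₀)
    (H.continuous x₀ hx₀) (Eventually.of_forall fun x => ?_) ?_ fun ξ => ?_
  · filter_upwards [self_mem_nhdsWithin] with x hx using H.integrable x hx
  · exact (hc.comp (continuous_const.prodMk continuous_id)).aestronglyMeasurable
  · filter_upwards [self_mem_nhdsWithin] with x hx using hM x hx
  · exact ((hc.comp (continuous_id.prodMk continuous_const)).tendsto x₀).mono_left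
      nhdsWithin_le_nhds

theorem tendsto_pairing (H : IsAbsorbedFlow g f φ) (hg : Integrable g) (hh : Continuous h)
    (hhs : HasCompactSupport h) (hκ : Continuous κ) :
    Tendsto (fun x => ∫ ξ, f x ξ * (h (energyCoord φ (x, ξ)) * κ (ξ 0))) atTop
      (𝓝 (∫ ξ, g ξ * (h (setNormal ξ (ξ 0 ^ 2 / 2)) * κ (ξ 0)))) := by
  obtain ⟨M, hM⟩ := exists_bound_energyCoord_mul hh hhs hκ fun x hx => H.potential_le hx
  have hc := H.continuous_pairing hh hκ
  refine tendsto_integral_mul_of_tendsto_eLpNorm (M := M) ?_ hg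
    H.tendsto_distribution (Eventually.of_forall fun x => ?_) ?_ fun ξ => ?_
  · filter_upwards [eventually_ge_atTop 0] with x hx using H.integrable x hx
  · exact (hc.comp (continuous_const.prodMk continuous_id)).aestronglyMeasurable
  · filter_upwards [eventually_ge_atTop 0] with x hx using hM x hx
  · have h1 : Continuous fun s : ℝ => h (setNormal ξ (ξ 0 ^ 2 / 2 - s)) * κ (ξ 0) :=
      (hh.comp (Continuous.setNormal continuous_const (by fun_prop))).mul continuous_const
    have h2 := (h1.tendsto 0).comp H.tendsto_potential
    rw [sub_zero] at h2
    exact h2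

/-- The flux of a conserved quantity is constant along the beam. -/
theorem flux_eq (H : IsAbsorbedFlow g f φ) (hg : Integrable g) (hh : ContDiff ℝ 1 h)
    (hhs : HasCompactSupport h) (hθ : ContDiff ℝ 1 θ)
    (hhθ : ∀ x, 0 < x → ∀ ξ : Velocity, h (energyCoord φ (x, ξ)) * deriv θ (ξ 0) = 0)
    {x : ℝ} (hx : 0 < x) :
    ∫ ξ, f x ξ * (h (energyCoord φ (x, ξ)) * (ξ 0 * θ (ξ 0)))
      = ∫ ξ, g ξ * (h (setNormal ξ (ξ 0 ^ 2 / 2)) * (ξ 0 * θ (ξ 0))) := by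
  have hκ : Continuous fun t : ℝ => t * θ t := continuous_id.mul hθ.continuous
  refine eq_of_forall_integral_deriv_mul_eq_zero
    ((H.continuousOn_pairing hh.continuous hhs hκ).mono Ioi_subset_Ici_self)
    (H.tendsto_pairing hg hh.continuous hhs hκ) (fun χ hχ hχs hχU => ?_) x hx
  -- `χ` vanishes at the wall, so the boundary condition on test functions holds for every `h` and
  -- `θ`.
  have hψ : IsTestFunction 0 (phaseTest φ χ h θ) := by
    refine ⟨contDiff_phaseTest H.contDiff hχ hh hθ,
      hasCompactSupport_phaseTest H.contDiff.continuous hχs hhs θ, fun ξ _ => ?_⟩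
    have h0 : χ 0 = 0 := image_eq_zero_of_notMem_tsupport fun h => lt_irrefl (0 : ℝ) (hχU h : (0 : ℝ) ∈ Ioi (0 : ℝ))
    simp [phaseTest, h0]
  refine Eq.trans ?_ (H.vlasov _ hψ)
  refine setIntegral_congr_fun measurableSet_Ioi fun y hy => ?_
  simp only [← integral_const_mul]
  congr 1
  funext ξ
  rw [fderiv_phaseTest_direction H.contDiff hχ hh hθ]
  simp only
  linear_combination (-(f y ξ * χ y * deriv φ y)) * hhθ y hy ξ

/-- Here `σ` is the direction of motion. A particle of positive energy keeps the sign of `ξ₁` on the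
whole half-line, so a test function of `ξ` supported in this region equals a function of the
conserved quantities times a cutoff in the sign of `ξ₁`. Constancy of the flux carries it to
infinity, where `g` is known. For `σ = 1` the accelerated beam vanishes there, so nothing moves away
from the wall. -/
theorem ae_eq_accelerated_of_passing (H : IsAbsorbedFlow g f φ) (hg : IsBeam a g) {σ : ℝ}
    (hσ : σ = 1 ∨ σ = -1) {x : ℝ} (hx : 0 < x) :
    ∀ᵐ ξ : Velocity, √(2 * φ x) < σ * ξ 0 → f x ξ = accelerated g (φ x) ξ := by
  have hp : 0 < φ x := H.potential_pos hx.le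
  have hσ2 : σ ^ 2 = 1 := by rcases hσ with rfl | rfl <;> norm_num
  set U : Set Velocity := {ξ | √(2 * φ x) < σ * ξ 0}
  have hU : IsOpen U := isOpen_lt continuous_const (by fun_prop)
  have hgi : Integrable g := hg.continuous.integrable_of_hasCompactSupport hg.hasCompactSupport
  have hloc : LocallyIntegrableOn (fun ξ : Velocity => ξ 0 * (f x ξ - accelerated g (φ x) ξ)) U :=
    (((H.integrable x hx.le).sub (hg.integrable_accelerated
      (φ x))).locallyIntegrable.locallyIntegrableOn U).continuousOn_mul
      (by fun_prop) hU.isLocallyClosed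
  suffices hae : ∀ᵐ ξ : Velocity, ξ ∈ U → ξ 0 * (f x ξ - accelerated g (φ x) ξ) = 0 by
    filter_upwards [hae] with ξ hξ hξU
    have h0 : ξ 0 ≠ 0 := fun h0 => by
      rw [h0, mul_zero] at hξU
      exact absurd hξU (not_lt.2 (Real.sqrt_nonneg _))
    exact sub_eq_zero.1 ((mul_eq_zero.1 (hξ hξU)).resolve_left h0)
  refine hU.ae_eq_zero_of_integral_contDiff_smul_eq_zero hloc fun k hk hks hkU => ?_
  have hk1 : ContDiff ℝ 1 k := hk.of_le (by exact_mod_cast le_top)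
  obtain ⟨m, hm, hkm⟩ := hks.isCompact.exists_forall_le' (f := fun ξ : Velocity => σ * ξ 0)
    (by fun_prop) hkU
  have hm0 : 0 < m := (Real.sqrt_nonneg _).trans_lt hm
  have hm2 : 2 * φ x < m ^ 2 := (Real.sqrt_lt' hm0).1 hm
  -- On the support of `k` the energy is at least `e > 0`, because compactness keeps `σ ξ₁` above
  -- some `m > √(2 φ x)`.
  set e := m ^ 2 / 2 - φ x with he
  have he0 : 0 < e := by rw [he]; linarith
  -- `k` in conserved coordinates: energy `E` corresponds at `x` to the normal velocity `σ √(2 (E +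
  -- φ x))`.
  set h : Velocity → ℝ := fun v => k (setNormal v (σ * √(2 * (v 0 + φ x))))
  have hhe : ∀ v, h v ≠ 0 → e ≤ v 0 := fun v hv => by
    have h1 := hkm _ (subset_tsupport _ hv)
    rw [setNormal_zero, ← mul_assoc, ← sq, hσ2, one_mul] at h1
    have h2 := (Real.le_sqrt' hm0).1 h1
    linarith
  have hh : ContDiff ℝ 1 h := by
    rw [contDiff_iff_contDiffAt]
    intro v
    by_cases hv : v 0 < e
    · have : h =ᶠ[𝓝 v] fun _ => 0 := by
        filter_upwards [(isOpen_lt (by fun_prop) continuous_const :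
          IsOpen {v : Velocity | v 0 < e}).mem_nhds hv] with w hw
        by_contra h0
        exact absurd (hhe w h0) (not_le.2 hw)
      exact contDiffAt_const.congr_of_eventuallyEq this
    · have h0 : 2 * (v 0 + φ x) ≠ 0 := by
        have := not_lt.1 hv
        linarith
      have hs : ContDiffAt ℝ 1 (fun v : Velocity => √(2 * (v 0 + φ x))) v :=
        ContDiffAt.sqrt (by fun_prop) h0
      refine hk1.contDiffAt.comp v ?_
      unfold setNormal
      fun_prop
  have hhs : HasCompactSupport h := by
    obtain ⟨R, hR⟩ := hks.isCompact.isBounded.exists_norm_le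
    refine HasCompactSupport.of_support_subset_isCompact
      (isCompact_closedBall (0 : Velocity) (√(R ^ 2 + (R ^ 2) ^ 2))) fun v hv => ?_
    have hv0 := hhe v hv
    have h1 := pow_le_pow_left₀ (norm_nonneg _) (hR _ (subset_tsupport _ hv)) 2
    have h3 : (σ * √(2 * (v 0 + φ x))) ^ 2 = 2 * (v 0 + φ x) := by
      rw [mul_pow, hσ2, one_mul, Real.sq_sqrt (by linarith)]
    have h4 := (normal_sq_le_norm_sq _).trans h1
    rw [setNormal_zero, h3] at h4
    rw [norm_sq_setNormal, h3] at h1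
    rw [mem_closedBall_zero_iff]
    refine Real.le_sqrt_of_sq_le ?_
    have h5 : v 0 ≤ R ^ 2 := by linarith
    have h6 : v 0 ^ 2 ≤ (R ^ 2) ^ 2 := pow_le_pow_left₀ (by linarith) h5 2
    linarith
  -- At energy at least `e` every position has `|ξ₁| ≥ √(2e) > b`. The transition zone of `θ` is
  -- therefore never met on the support of `h`, which gives the hypothesis of `flux_eq`.
  set b := √e
  have hb : 0 < b := Real.sqrt_pos.2 he0
  have hb2 : b ^ 2 = e := Real.sq_sqrt he0.le
  set θ : ℝ → ℝ := fun t => Real.smoothTransition (σ * t / b)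
  have hθ : ContDiff ℝ 1 θ := Real.smoothTransition.contDiff.comp (by fun_prop)
  have hθ1 : ∀ t, b ≤ σ * t → θ t = 1 := fun t ht =>
    Real.smoothTransition.one_of_one_le ((one_le_div hb).2 ht)
  have hθ0 : ∀ t, σ * t ≤ 0 → θ t = 0 := fun t ht =>
    Real.smoothTransition.zero_of_nonpos (div_nonpos_of_nonpos_of_nonneg ht hb.le)
  have habs : ∀ t, |σ * t| = |t| := fun t => by rcases hσ with rfl | rfl <;> simp
  have hθd : ∀ t, b < |t| → deriv θ t = 0 := fun t ht => by
    have hc : Continuous fun s => σ * s := by fun_prop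
    rw [← habs, lt_abs] at ht
    rcases ht with ht | ht
    · have : θ =ᶠ[𝓝 t] fun _ => 1 := by
        filter_upwards [(isOpen_lt continuous_const hc).mem_nhds ht] with s hs
        exact hθ1 s (le_of_lt hs)
      rw [this.deriv_eq, deriv_const]
    · have : θ =ᶠ[𝓝 t] fun _ => 0 := by
        filter_upwards [(isOpen_lt continuous_const hc.neg).mem_nhds ht] with s hs
        have hs' : b < -(σ * s) := hs
        exact hθ0 s (by linarith)
      rw [this.deriv_eq, deriv_const]
  have hbt : ∀ t, e ≤ t ^ 2 / 2 → b < |t| := fun t ht => by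
    rw [← Real.sqrt_sq_eq_abs]
    exact Real.sqrt_lt_sqrt he0.le (by linarith)
  have hflux := H.flux_eq hgi hh hhs hθ (fun y hy ξ => ?_) hx
  · have hkey : ∀ ξ : Velocity, h (energyCoord φ (x, ξ)) * θ (ξ 0) = k ξ := fun ξ => by
      have h1 : h (energyCoord φ (x, ξ)) = k (setNormal ξ (σ * |ξ 0|)) := by
        simp only [h, energyCoord_zero]
        rw [energyCoord, setNormal_setNormal, ← Real.sqrt_sq_eq_abs]
        congr 4
        ring
      by_cases hξ : 0 < σ * ξ 0
      · have h2 : σ * |ξ 0| = ξ 0 := by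
          rw [← habs, abs_of_pos hξ, ← mul_assoc, ← sq, hσ2, one_mul]
        rw [h2, setNormal_self] at h1
        by_cases hk0 : k ξ = 0
        · rw [h1, hk0, zero_mul]
        · have h3 := hhe _ (h1 ▸ hk0)
          rw [energyCoord_zero] at h3
          have h4 := hbt (ξ 0) (by linarith)
          rw [← habs, abs_of_pos hξ] at h4
          rw [h1, hθ1 _ h4.le, mul_one]
      · rw [hθ0 _ (not_lt.1 hξ), mul_zero]
        refine (image_eq_zero_of_notMem_tsupport fun h2 => hξ ?_).symm
        exact (Real.sqrt_nonneg _).trans_lt (hkU h2)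
    have h1 : ∫ ξ, f x ξ * (k ξ * ξ 0) = ∫ ξ, accelerated g (φ x) ξ * (k ξ * ξ 0) := by
      rw [hg.integral_accelerated_mul hp.le]
      refine Eq.trans ?_ (hflux.trans ?_)
      · refine integral_congr_ae (Eventually.of_forall fun ξ => ?_)
        simp only [← hkey ξ]
        ring
      · refine integral_congr_ae (Eventually.of_forall fun η => ?_)
        by_cases hgη : g η = 0
        · simp [hgη]
        have hη : η 0 < 0 := by linarith [hg.normal_lt η hgη, hg.one_lt]
        have hS := accelerate_normal_le hp.le η
        have hsq : 0 < η 0 ^ 2 + 2 * φ x := by positivity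
        have h2 : energyCoord φ (x, accelerate (φ x) η) = setNormal η (η 0 ^ 2 / 2) := by
          simp only [energyCoord, accelerate, setNormal_setNormal, setNormal_zero, neg_sq,
            Real.sq_sqrt hsq.le]
          congr 1
          ring
        have h3 : speedRatio (η 0) (φ x) * accelerate (φ x) η 0 = η 0 := by
          have := (Real.sqrt_pos.2 hsq).ne'
          simp only [speedRatio, accelerate, setNormal_zero, abs_of_neg hη]
          field_simp
        have h4 : h (setNormal η (η 0 ^ 2 / 2)) * θ (accelerate (φ x) η 0)
            = h (setNormal η (η 0 ^ 2 / 2)) * θ (η 0) := by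
          by_cases h0 : h (setNormal η (η 0 ^ 2 / 2)) = 0
          · rw [h0, zero_mul, zero_mul]
          have h5 := hhe _ h0
          rw [setNormal_zero] at h5
          have h6 := hbt _ h5
          rw [abs_of_neg hη] at h6
          rcases hσ with rfl | rfl
          · rw [hθ0 _ (by linarith), hθ0 _ (by linarith)]
          · rw [hθ1 _ (by linarith), hθ1 _ (by linarith)]
        have h7 : h (setNormal η (η 0 ^ 2 / 2)) * θ (η 0) = k (accelerate (φ x) η) := by
          rw [← hkey (accelerate (φ x) η), h2, h4]
        calc g η * (h (setNormal η (η 0 ^ 2 / 2)) * (η 0 * θ (η 0)))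
            = g η * (h (setNormal η (η 0 ^ 2 / 2)) * θ (η 0) * η 0) := by ring
          _ = g η * (k (accelerate (φ x) η)
                * (speedRatio (η 0) (φ x) * accelerate (φ x) η 0)) := by rw [h7, h3]
          _ = _ := by ring
    have hkc : Continuous fun ξ : Velocity => k ξ * ξ 0 := hk1.continuous.mul (by fun_prop)
    obtain ⟨M, hM⟩ := (hks.mul_right (f' := fun ξ : Velocity => ξ 0)).exists_bound_of_continuous hkc
    have h2 := (H.integrable x hx.le).mul_bdd hkc.aestronglyMeasurable (Eventually.of_forall hM)
    have h3 := (hg.integrable_accelerated (φ x)).mul_bdd hkc.aestronglyMeasurable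
      (Eventually.of_forall hM)
    rw [← sub_eq_zero, ← integral_sub h2 h3] at h1
    rw [← h1]
    congr 1
    funext ξ
    simp only [smul_eq_mul]
    ring
  · by_cases h0 : h (energyCoord φ (y, ξ)) = 0
    · rw [h0, zero_mul]
    · have h1 := hhe _ h0
      rw [energyCoord_zero] at h1
      rw [hθd _ (hbt _ (by linarith [H.potential_pos hy.le])), mul_zero]

end IsAbsorbedFlow

end

/-! ### Reflected particles, and uniqueness of the distribution for a given potential. -/

section

namespace IsAbsorbedFlow

variable {a : ℝ} {g h : Velocity → ℝ} {f : ℝ → Velocity → ℝ} {φ : ℝ → ℝ}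

/-- No particles with energies at which they are reflected back to the absorbing wall. -/
theorem integral_eq_zero_of_reflected (H : IsAbsorbedFlow g f φ) {δ : ℝ} (hδ : 0 < δ)
    (hh : ContDiff ℝ 1 h) (hhs : HasCompactSupport h) (hh0 : ∀ v, 0 ≤ h v)
    (hhW : tsupport h ⊆ {v | -φ 0 < v 0 ∧ v 0 < -δ}) {x : ℝ} (hx : 0 < x) :
    ∫ ξ, f x ξ * h (energyCoord φ (x, ξ)) = 0 := by
  -- The square root is the normal speed at the wall of a particle with energy `v 0`. It is smooth
  -- on the support of `h`, where the energy exceeds `-φ 0`.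
  set h₂ : Velocity → ℝ := fun v => h v * √(2 * (φ 0 + v 0))
  have hh₂ : ContDiff ℝ 1 h₂ := by
    rw [contDiff_iff_contDiffAt]
    intro v
    by_cases hv : v ∈ tsupport h
    · have h0 : 2 * (φ 0 + v 0) ≠ 0 := by
        have := (hhW hv).1
        linarith
      exact hh.contDiffAt.mul (ContDiffAt.sqrt (by fun_prop) h0)
    · have : h₂ =ᶠ[𝓝 v] fun _ => 0 := by
        filter_upwards [notMem_tsupport_iff_eventuallyEq.1 hv] with w hw
        simp [h₂, hw]
      exact contDiffAt_const.congr_of_eventuallyEq this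
  obtain ⟨X, hX⟩ := (H.tendsto_potential.eventually (gt_mem_nhds hδ)).exists_forall_of_atTop
  have hout : ∀ y, X ≤ y → ∀ ξ : Velocity, h (energyCoord φ (y, ξ)) = 0 := fun y hy ξ => by
    refine image_eq_zero_of_notMem_tsupport fun h1 => ?_
    have h2 := (hhW h1).2
    rw [energyCoord_zero] at h2
    have h3 := hX y hy
    simp only at h2
    nlinarith [sq_nonneg (ξ 0)]
  let χ : ContDiffBump (0 : ℝ) := ⟨|X| + 1, |X| + 2, by positivity, by linarith⟩
  have hχ : ContDiff ℝ 1 χ := χ.contDiff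
  -- Up to `χ`, this is `h(E) (ξ₁ + wall speed)`. At the wall with `ξ₁ < 0` the bracket vanishes, so
  -- `ψ` is admissible; its transport derivative is `h(E) φ'`, of one sign. The cutoff `χ` costs
  -- nothing, since energies below `-δ` do not occur beyond `X`.
  set ψ : ℝ × Velocity → ℝ := fun z => phaseTest φ χ h id z + phaseTest φ χ h₂ (fun _ => 1) z
  have hψ₁ := contDiff_phaseTest H.contDiff hχ hh contDiff_id
  have hψ₂ := contDiff_phaseTest H.contDiff hχ hh₂ (contDiff_const (c := (1 : ℝ)))
  have hψ : IsTestFunction 0 ψ := by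
    refine ⟨hψ₁.add hψ₂, (hasCompactSupport_phaseTest H.contDiff.continuous χ.hasCompactSupport
      hhs _).add (hasCompactSupport_phaseTest H.contDiff.continuous χ.hasCompactSupport
      hhs.mul_right _), fun ξ hξ => ?_⟩
    have h1 : reflect ξ 0 = -ξ 0 := by simp [reflect]
    have h2 : 2 * (φ 0 + ((-ξ 0) ^ 2 / 2 - φ 0)) = ξ 0 ^ 2 := by ring
    simp only [ψ, phaseTest, h₂, energyCoord_zero, h1, h2, Real.sqrt_sq hξ.le, id]
    ring
  have hfd : ∀ y, 0 < y → ∀ ξ : Velocity, fderiv ℝ ψ (y, ξ) (direction φ (y, ξ))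
      = h (energyCoord φ (y, ξ)) * deriv φ y := fun y hy ξ => by
    have h1 : fderiv ℝ ψ (y, ξ) = fderiv ℝ (phaseTest φ χ h id) (y, ξ)
        + fderiv ℝ (phaseTest φ χ h₂ fun _ => 1) (y, ξ) :=
      fderiv_add (hψ₁.differentiable one_ne_zero _) (hψ₂.differentiable one_ne_zero _)
    rw [h1, add_apply, fderiv_phaseTest_direction H.contDiff hχ hh contDiff_id,
      fderiv_phaseTest_direction H.contDiff hχ hh₂ contDiff_const]
    rcases le_or_gt X y with hXy | hXy
    · simp [h₂, hout y hXy ξ]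
    · have h2 : y ∈ Metric.ball (0 : ℝ) χ.rIn := by
        rw [mem_ball_zero_iff, Real.norm_eq_abs, abs_of_pos hy]
        exact hXy.trans_le ((le_abs_self X).trans (by simp [χ]))
      have h3 := χ.eventuallyEq_one_of_mem_ball h2
      have h4 : deriv χ y = 0 := by
        rw [h3.deriv_eq]
        exact deriv_const y (1 : ℝ)
      have h5 : χ y = 1 := h3.self_of_nhds
      simp [h4, h5]
  set F : ℝ → ℝ := fun y => ∫ ξ, f y ξ * h (energyCoord φ (y, ξ))
  have hFc : ContinuousOn F (Ici 0) := by
    simpa using H.continuousOn_pairing hh.continuous hhs (continuous_const (y := (1 : ℝ)))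
  have hF0 : ∀ y, 0 ≤ y → 0 ≤ F y := fun y hy => by
    refine integral_nonneg_of_ae ?_
    filter_upwards [H.nonneg y hy] with ξ hξ using mul_nonneg hξ (hh0 _)
  have hFout : ∀ y, X ≤ y → F y = 0 := fun y hy => by
    simp only [F, hout y hy, mul_zero, integral_zero]
  have hφ' : Continuous (deriv φ) := H.contDiff.continuous_deriv le_rfl
  have hint : ∫ y in Ioi (0 : ℝ), -deriv φ y * F y = 0 := by
    have h1 : ∫ y in Ioi (0 : ℝ), deriv φ y * F y = 0 := by
      refine Eq.trans ?_ (H.vlasov ψ hψ)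
      refine setIntegral_congr_fun measurableSet_Ioi fun y hy => ?_
      simp only [F, ← integral_const_mul]
      congr 1
      funext ξ
      rw [hfd y hy ξ]
      ring
    simp only [neg_mul, integral_neg, h1, neg_zero]
  have hGc : ContinuousOn (fun y => -deriv φ y * F y) (Ici 0) :=
    (hφ'.neg.continuousOn).mul hFc
  have hGi : IntegrableOn (fun y => -deriv φ y * F y) (Ioi 0) := by
    have h1 : IntegrableOn (fun y => -deriv φ y * F y) (Icc 0 X) :=
      (hGc.mono Icc_subset_Ici_self).integrableOn_compact isCompact_Icc
    refine h1.of_forall_sdiff_eq_zero measurableSet_Ioi fun y hy => ?_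
    rw [hFout y (not_lt.1 fun h2 => hy.2 ⟨le_of_lt hy.1, h2.le⟩), mul_zero]
  have hae := (setIntegral_eq_zero_iff_of_nonneg_ae (by
    filter_upwards [ae_restrict_mem measurableSet_Ioi] with y hy
    exact mul_nonneg (neg_pos.2 (H.deriv_neg y (le_of_lt hy))).le (hF0 y (le_of_lt hy))) hGi).1 hint
  have heq := Measure.eqOn_open_of_ae_eq hae isOpen_Ioi (hGc.mono Ioi_subset_Ici_self)
    continuousOn_const hx
  exact (mul_eq_zero.1 heq).resolve_left (neg_pos.2 (H.deriv_neg x hx.le)).ne'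

theorem ae_eq_zero_of_reflected (H : IsAbsorbedFlow g f φ) {x : ℝ} (hx : 0 < x) :
    ∀ᵐ ξ : Velocity, ξ 0 ^ 2 < 2 * φ x → f x ξ = 0 := by
  have hset : {ξ : Velocity | ¬(ξ 0 ^ 2 < 2 * φ x → f x ξ = 0)}
      = {ξ | ξ 0 ^ 2 < 2 * φ x ∧ f x ξ ≠ 0} := by
    ext ξ
    simp
  rw [ae_iff, hset]
  refine measure_null_of_locally_null _ fun ξ₀ hξ₀ => ?_
  have he0 : ξ₀ 0 ^ 2 / 2 - φ x < 0 := by linarith [hξ₀.1]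
  have hφx : φ x < φ 0 := H.strictAntiOn self_mem_Ici hx.le hx
  -- Half the depth of the energy of `ξ₀`, so this energy lies strictly inside the window; it
  -- exceeds `-φ 0` because `φ` is strictly decreasing.
  set δ := -(ξ₀ 0 ^ 2 / 2 - φ x) / 2 with hδ
  have hδ0 : 0 < δ := by rw [hδ]; linarith
  have hW : {v : Velocity | -φ 0 < v 0 ∧ v 0 < -δ} ∈ 𝓝 (energyCoord φ (x, ξ₀)) := by
    have hc₀ : Continuous fun v : Velocity => v 0 := by fun_prop
    refine ((isOpen_lt continuous_const hc₀).inter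
      (isOpen_lt hc₀ continuous_const)).mem_nhds ⟨?_, ?_⟩
    · show -φ 0 < energyCoord φ (x, ξ₀) 0
      rw [energyCoord_zero]
      simp only
      nlinarith [sq_nonneg (ξ₀ 0)]
    · show energyCoord φ (x, ξ₀) 0 < -δ
      rw [energyCoord_zero, hδ]
      simp only
      linarith
  obtain ⟨h, hhW, hhs, hh, hhr, hh1⟩ := exists_contDiff_tsupport_subset (n := 1) hW
  have hh0 : ∀ v, 0 ≤ h v := fun v => (hhr ⟨v, rfl⟩).1
  have hc : Continuous fun ξ => h (energyCoord φ (x, ξ)) :=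
    hh.continuous.comp ((contDiff_energyCoord H.contDiff).continuous.comp
      (continuous_const.prodMk continuous_id))
  have hzero := H.integral_eq_zero_of_reflected hδ0 hh hhs hh0 hhW hx
  obtain ⟨M, hM⟩ := hhs.exists_bound_of_continuous hh.continuous
  have hint := (H.integrable x hx.le).mul_bdd hc.aestronglyMeasurable
    (Eventually.of_forall fun ξ => hM _)
  have hae := (integral_eq_zero_iff_of_nonneg_ae (by
    filter_upwards [H.nonneg x hx.le] with ξ hξ using mul_nonneg hξ (hh0 _)) hint).1 hzero
  refine ⟨_, inter_mem_nhdsWithin _ ((isOpen_lt continuous_const hc).mem_nhds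
    (by simp only [mem_ofPred_eq, hh1]; exact one_pos)), ?_⟩
  refine measure_mono_null (fun ξ hξ => ?_) (ae_iff.1 hae)
  exact mul_ne_zero hξ.1.2 (ne_of_gt hξ.2)

/-- The Vlasov equation determines the distribution in terms of the potential. -/
theorem ae_eq_accelerated (H : IsAbsorbedFlow g f φ) (hg : IsBeam a g) {x : ℝ} (hx : 0 ≤ x) :
    f x =ᵐ[volume] accelerated g (φ x) := by
  have hpos : ∀ x, 0 < x → f x =ᵐ[volume] accelerated g (φ x) := fun x hx => by
    filter_upwards [H.ae_eq_accelerated_of_passing hg (Or.inl rfl) hx,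
      H.ae_eq_accelerated_of_passing hg (Or.inr rfl) hx, H.ae_eq_zero_of_reflected hx,
      measure_eq_zero_iff_ae_notMem.1 (volume_normal_eq (√(2 * φ x))),
      measure_eq_zero_iff_ae_notMem.1 (volume_normal_eq (-√(2 * φ x)))] with ξ h1 h2 h3 h4 h5
    rcases lt_or_ge (√(2 * φ x)) (1 * ξ 0) with h6 | h6
    · exact h1 h6
    rcases lt_or_ge (√(2 * φ x)) (-1 * ξ 0) with h7 | h7
    · exact h2 h7
    have h8 : ξ 0 < √(2 * φ x) := lt_of_le_of_ne (by linarith) h4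
    have h9 : -√(2 * φ x) < ξ 0 := lt_of_le_of_ne (by linarith) (Ne.symm h5)
    have h10 : ξ 0 ^ 2 < 2 * φ x := by
      have := sq_lt_sq' h9 h8
      rwa [Real.sq_sqrt (by linarith [H.potential_pos hx.le])] at this
    rw [h3 h10]
    by_contra h11
    exact absurd (hg.accelerated_ne_zero (Ne.symm h11)).2.1 (not_lt.2 h10.le)
  rcases hx.eq_or_lt with rfl | hx
  -- At the wall itself, both sides are right limits in `L¹` of their values for `x > 0`.
  · have h1 := (H.continuous 0 le_rfl).mono_left (nhdsWithin_mono 0 Ioi_subset_Ici_self)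
    have h2 := hg.tendsto_accelerated ((H.contDiff.continuous.tendsto 0).mono_left
      (nhdsWithin_le_nhds (s := Ioi 0)))
    have h3 := h1.add h2
    rw [add_zero] at h3
    have hm : ∀ p, AEStronglyMeasurable (accelerated g p) volume := fun p =>
      (hg.integrable_accelerated p).aestronglyMeasurable
    have h4 : eLpNorm (fun ξ => f 0 ξ - accelerated g (φ 0) ξ) 1 volume = 0 := by
      refine le_antisymm (ge_of_tendsto h3 ?_) zero_le
      filter_upwards [self_mem_nhdsWithin] with y hy
      have hy0 : (0 : ℝ) < y := hy
      have h5 := eLpNorm_sub_le (μ := volume) (p := 1)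
        (f := fun ξ => accelerated g (φ y) ξ - accelerated g (φ 0) ξ)
        (g := fun ξ => f y ξ - f 0 ξ) ((hm _).sub (hm _))
        ((H.integrable y hy0.le).aestronglyMeasurable.sub
          (H.integrable 0 le_rfl).aestronglyMeasurable) le_rfl
      rw [add_comm]
      refine le_trans (le_of_eq ?_) h5
      refine eLpNorm_congr_ae ?_
      filter_upwards [hpos y hy0] with ξ hξ
      simp only [Pi.sub_apply, hξ]
      ring
    have h5 := (eLpNorm_eq_zero_iff ((H.integrable 0 le_rfl).aestronglyMeasurable.sub (hm _))
      one_ne_zero).1 h4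
    filter_upwards [h5] with ξ hξ using sub_eq_zero.1 hξ
  · exact hpos x hx

end IsAbsorbedFlow

namespace IsVlasovPoissonSolution

variable {ne : ℝ → ℝ} {φb : ℝ} {g : Velocity → ℝ} {f : ℝ → Velocity → ℝ} {φ : ℝ → ℝ}

theorem dx_neg (H : IsVlasovPoissonSolution ne (fun _ => 0) 0 φb g f φ) (hφb : 0 < φb) :
    ∀ x, 0 ≤ x → dx φ x < 0 := by
  refine H.monotone.resolve_left fun hpos => ?_
  obtain ⟨φ', h1, h2, h3⟩ := exists_contDiff_one_extension H.contDiffOn_one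
  have hmono : StrictMonoOn φ' (Ici 0) :=
    strictMonoOn_of_deriv_pos (convex_Ici 0) h1.continuous.continuousOn fun x hx => by
      rw [interior_Ici] at hx
      rw [h3 x (le_of_lt hx)]
      exact hpos x (le_of_lt hx)
  have h4 : φb ≤ 0 := by
    refine ge_of_tendsto H.tendsto_potential ?_
    filter_upwards [eventually_ge_atTop 0] with x hx
    rw [← H.boundary_potential, h2 self_mem_Ici, h2 hx]
    exact hmono.monotoneOn self_mem_Ici hx hx
  linarith

theorem exists_isAbsorbedFlow (H : IsVlasovPoissonSolution ne (fun _ => 0) 0 φb g f φ)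
    (hφb : 0 < φb) : ∃ φ', EqOn φ φ' (Ici 0) ∧ IsAbsorbedFlow g f φ' := by
  obtain ⟨φ', h1, h2, h3⟩ := exists_contDiff_one_extension H.contDiffOn_one
  refine ⟨φ', h2, h1, fun x hx => (h3 x hx).trans_lt (H.dx_neg hφb x hx), ?_, H.locallyIntegrable,
    H.integrable, H.continuous, H.nonneg,
    (weakVlasov_iff_of_absorbing H.locallyIntegrable h1 h2).1 H.vlasov, H.tendsto_distribution⟩
  refine H.tendsto_potential.congr' ?_
  filter_upwards [eventually_ge_atTop 0] with x hx using h2 hx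

end IsVlasovPoissonSolution

end

/-! ### Ion density as a function of the potential, and its dependence on the beam. -/

section

theorem speedRatio_nonneg (t s : ℝ) : 0 ≤ speedRatio t s := by
  unfold speedRatio; positivity

theorem speedRatio_abs (t s : ℝ) : speedRatio |t| s = speedRatio t s := by
  simp only [speedRatio, abs_abs, sq_abs]

theorem speedRatio_le_one (t : ℝ) {s : ℝ} (hs : 0 ≤ s) : speedRatio t s ≤ 1 :=
  div_le_one_of_le₀ (Real.abs_le_sqrt (by linarith)) (Real.sqrt_nonneg _)

theorem speedRatio_zero {t : ℝ} (ht : t ≠ 0) : speedRatio t 0 = 1 := by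
  rw [speedRatio, mul_zero, add_zero, Real.sqrt_sq_eq_abs, div_self (abs_ne_zero.2 ht)]

theorem speedRatio_pos {t s : ℝ} (ht : t ≠ 0) (hs : 0 ≤ s) : 0 < speedRatio t s :=
  div_pos (abs_pos.2 ht) (Real.sqrt_pos.2 (by positivity))

/-- With `A`, `B` the two speeds and `τ = |t|`, the difference is `τ (B - A) / (AB)`. Now `(B - A)(A
+ B) = 2 (s' - s)`, `A + B ≥ 2τ` and `AB ≥ a²`. The resulting constant `1 / a²` is the one in the
Bohm criterion. -/
theorem speedRatio_sub_le {a t s s' : ℝ} (ha : 0 < a) (ht : a ≤ |t|) (hs : 0 ≤ s) (hss : s ≤ s') :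
    0 ≤ speedRatio t s - speedRatio t s' ∧
      speedRatio t s - speedRatio t s' ≤ 1 / a ^ 2 * (s' - s) := by
  rw [← speedRatio_abs t, ← speedRatio_abs t]
  obtain ⟨τ, hτ⟩ : ∃ τ, τ = |t| := ⟨_, rfl⟩
  rw [← hτ] at ht ⊢
  have hτ0 : 0 < τ := ha.trans_le ht
  rw [speedRatio, speedRatio, abs_of_pos hτ0]
  have hA2 : √(τ ^ 2 + 2 * s) ^ 2 = τ ^ 2 + 2 * s := Real.sq_sqrt (by positivity)
  have hB2 : √(τ ^ 2 + 2 * s') ^ 2 = τ ^ 2 + 2 * s' := Real.sq_sqrt (by nlinarith)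
  have hτA : τ ≤ √(τ ^ 2 + 2 * s) := Real.le_sqrt_of_sq_le (by linarith)
  have hAB : √(τ ^ 2 + 2 * s) ≤ √(τ ^ 2 + 2 * s') := Real.sqrt_le_sqrt (by linarith)
  set A := √(τ ^ 2 + 2 * s)
  set B := √(τ ^ 2 + 2 * s')
  have hA : 0 < A := hτ0.trans_le hτA
  have hB : 0 < B := hA.trans_le hAB
  have h1 : τ / A - τ / B = τ * (B - A) / (A * B) := by field_simp
  rw [h1]
  constructor
  · exact div_nonneg (mul_nonneg hτ0.le (by linarith)) (by positivity)
  · have h2 : (B - A) * (A + B) = 2 * (s' - s) := by nlinarith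
    have h3 : τ * (B - A) * (2 * τ) ≤ τ * ((B - A) * (A + B)) := by
      rw [mul_assoc]
      exact mul_le_mul_of_nonneg_left (mul_le_mul_of_nonneg_left (by linarith) (by linarith))
        hτ0.le
    have h4 : τ * (B - A) ≤ s' - s := by
      rw [h2] at h3
      nlinarith
    have h5 : a ^ 2 ≤ A * B := by
      rw [sq]
      exact mul_le_mul (ht.trans hτA) (ht.trans (hτA.trans hAB)) ha.le hA.le
    rw [one_div_mul_eq_div]
    exact div_le_div₀ (by linarith) h4 (by positivity) h5

theorem speedRatio_mono {t t' s : ℝ} (ht : 0 < t) (htt : t ≤ t') (hs : 0 ≤ s) :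
    speedRatio t s ≤ speedRatio t' s := by
  have ht' := ht.trans_le htt
  have hA : 0 < t ^ 2 + 2 * s := by positivity
  have hA' : 0 < t' ^ 2 + 2 * s := by positivity
  rw [speedRatio, speedRatio, abs_of_pos ht, abs_of_pos ht',
    div_le_div_iff₀ (Real.sqrt_pos.2 hA) (Real.sqrt_pos.2 hA')]
  refine abs_le_of_sq_le_sq' ?_ (by positivity) |>.2
  rw [mul_pow, mul_pow, Real.sq_sqrt hA.le, Real.sq_sqrt hA'.le]
  have : t ^ 2 ≤ t' ^ 2 := pow_le_pow_left₀ ht.le htt 2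
  nlinarith

theorem speedRatio_sub_le_of_le {t t' s : ℝ} (ht : 1 ≤ t) (htt : t ≤ t') (hs : 0 ≤ s) :
    speedRatio t' s - speedRatio t s ≤ t' - t := by
  have hA : 0 < √(t ^ 2 + 2 * s) := Real.sqrt_pos.2 (by positivity)
  have hA1 : 1 ≤ √(t' ^ 2 + 2 * s) := Real.one_le_sqrt.2 (by nlinarith)
  have h1 : √(t ^ 2 + 2 * s) ≤ √(t' ^ 2 + 2 * s) :=
    Real.sqrt_le_sqrt (by nlinarith)
  have h2 : t / √(t' ^ 2 + 2 * s) ≤ speedRatio t s := by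
    rw [speedRatio, abs_of_pos (by linarith)]
    exact div_le_div_of_nonneg_left (by linarith) hA h1
  calc speedRatio t' s - speedRatio t s
      ≤ t' / √(t' ^ 2 + 2 * s) - t / √(t' ^ 2 + 2 * s) := by
        rw [speedRatio, abs_of_pos (by linarith)]
        linarith
    _ = (t' - t) / √(t' ^ 2 + 2 * s) := by rw [sub_div]
    _ ≤ t' - t := div_le_self (by linarith) hA1

theorem abs_speedRatio_sub_le {t t' s : ℝ} (ht : 1 ≤ t) (ht' : 1 ≤ t') (hs : 0 ≤ s) :
    |speedRatio t s - speedRatio t' s| ≤ |t - t'| := by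
  rcases le_total t t' with h | h
  · rw [abs_sub_comm, abs_of_nonneg (sub_nonneg.2 (speedRatio_mono (by linarith) h hs)),
      abs_sub_comm, abs_of_nonneg (sub_nonneg.2 h)]
    exact speedRatio_sub_le_of_le ht h hs
  · rw [abs_of_nonneg (sub_nonneg.2 (speedRatio_mono (by linarith) h hs)),
      abs_of_nonneg (sub_nonneg.2 h)]
    exact speedRatio_sub_le_of_le ht' h hs

/-- A density of ions as a function of the potential, satisfying the Bohm criterion if `κ < 1`. -/
structure IsIonDensity (κ : ℝ) (N : ℝ → ℝ) : Prop where
  zero : N 0 = 1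
  antitone : ∀ s t, 0 ≤ s → s ≤ t → N t ≤ N s
  sub_le : ∀ s t, 0 ≤ s → s ≤ t → N s - N t ≤ κ * (t - s)

theorem isIonDensity_speedRatio {a t : ℝ} (ha : 0 < a) (hat : a ≤ t) :
    IsIonDensity (1 / a ^ 2) (speedRatio t) := by
  have h : a ≤ |t| := hat.trans (le_abs_self t)
  exact ⟨speedRatio_zero (ha.trans_le hat).ne',
    fun s s' hs hss => sub_nonneg.1 (speedRatio_sub_le ha h hs hss).1,
    fun s s' hs hss => (speedRatio_sub_le ha h hs hss).2⟩

namespace IsIonDensity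

variable {κ δ φb : ℝ} {N : ℝ → ℝ}

/-- At `-log((1 + κ) / 2)` the electron density `exp(-t)` has dropped to `(1 + κ) / 2`. Up to there
it loses at least `(1 + κ) / 2` per unit of potential and the ions at most `κ`, leaving `(1 - κ) /
2`. -/
theorem force_sub_ge (hN : IsIonDensity κ N) (hκ : 0 < κ) (hδ : δ ≤ -Real.log ((1 + κ) / 2))
    (s t : ℝ) (hs : 0 ≤ s) (hst : s ≤ t) (ht : t ≤ δ) :
    (1 - κ) / 2 * (t - s) ≤ N t - Real.exp (-t) - (N s - Real.exp (-s)) := by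
  have h1 := hN.sub_le s t hs hst
  have h2 : (1 + κ) / 2 ≤ Real.exp (-t) := by
    rw [← Real.log_le_iff_le_exp (by linarith)]
    linarith
  have h3 : Real.exp (-t) * (1 + (t - s)) ≤ Real.exp (-s) := by
    have h4 : Real.exp (-s) = Real.exp (-t) * Real.exp (t - s) := by
      rw [← Real.exp_add]; congr 1; ring
    rw [h4]
    have := Real.add_one_le_exp (t - s)
    exact mul_le_mul_of_nonneg_left (by linarith) (Real.exp_pos _).le
  nlinarith

theorem continuousOn (hN : IsIonDensity κ N) : ContinuousOn N (Ici 0) := by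
  have h : LipschitzOnWith (Real.toNNReal κ) N (Ici 0) := by
    refine LipschitzOnWith.of_dist_le_mul fun s hs t ht => ?_
    have key : ∀ s t : ℝ, 0 ≤ s → s ≤ t → |N s - N t| ≤ (Real.toNNReal κ) * |s - t| :=
      fun s t hs hst => by
        rw [abs_of_nonneg (sub_nonneg.2 (hN.antitone s t hs hst)), abs_sub_comm,
          abs_of_nonneg (sub_nonneg.2 hst)]
        exact (hN.sub_le s t hs hst).trans
          (mul_le_mul_of_nonneg_right (Real.le_coe_toNNReal κ) (sub_nonneg.2 hst))
    rw [Real.dist_eq, Real.dist_eq]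
    rcases le_total s t with hst | hst
    · exact key s t hs hst
    · rw [abs_sub_comm, abs_sub_comm s]
      exact key t s ht hst
  exact h.continuousOn

theorem exists_potential (hN : IsIonDensity κ N) (hκ : 0 < κ) (hκ1 : κ < 1) (hφb : 0 < φb)
    (hδ : φb ≤ -Real.log ((1 + κ) / 2)) :
    ∃ φ : ℝ → ℝ, ContDiff ℝ 2 φ ∧ φ 0 = φb ∧ (∀ x, 0 < φ x) ∧ (∀ x, deriv φ x < 0) ∧
      (∀ x, 0 ≤ x → φ x ≤ φb) ∧
      (∀ x, 0 ≤ x → deriv (deriv φ) x = N (φ x) - Real.exp (-φ x)) ∧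
      Tendsto φ atTop (𝓝 0) := by
  refine exists_decaying_solution (F := fun s => N s - Real.exp (-s)) (c := (1 - κ) / 2)
    (by linarith) (by linarith) hφb le_rfl ?_ (fun s hs => ?_) (fun s hs => ?_)
  · exact (hN.continuousOn.mono Icc_subset_Ici_self).sub (by fun_prop)
  · have := hN.force_sub_ge hκ hδ 0 s le_rfl hs.1 hs.2
    simp only [hN.zero, neg_zero, Real.exp_zero, sub_self, sub_zero] at this
    exact this
  · have h1 := hN.antitone 0 s le_rfl hs.1
    rw [hN.zero] at h1
    have h2 := Real.add_one_le_exp (-s)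
    linarith

/-- Decaying potentials for two ion densities with the same boundary value. -/
theorem abs_potential_sub_le {N₁ N₂ φ₁ φ₂ : ℝ → ℝ} {η : ℝ} (hN : IsIonDensity κ N₁) (hκ : 0 < κ)
    (hκ1 : κ < 1) (hδ : φb ≤ -Real.log ((1 + κ) / 2)) (hη : 0 ≤ η)
    (hNN : ∀ s, 0 ≤ s → |N₁ s - N₂ s| ≤ η)
    (hc₁ : ContinuousOn φ₁ (Ici 0)) (hc₂ : ContinuousOn φ₂ (Ici 0))
    (hd₁ : ContDiffOn ℝ 2 φ₁ (Ioi 0)) (hd₂ : ContDiffOn ℝ 2 φ₂ (Ioi 0))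
    (hb₁ : ∀ x, 0 ≤ x → φ₁ x ∈ Icc 0 φb) (hb₂ : ∀ x, 0 ≤ x → φ₂ x ∈ Icc 0 φb)
    (h0 : φ₁ 0 = φ₂ 0) (hl₁ : Tendsto φ₁ atTop (𝓝 0)) (hl₂ : Tendsto φ₂ atTop (𝓝 0))
    (he₁ : ∀ x, 0 < x → deriv (deriv φ₁) x = N₁ (φ₁ x) - Real.exp (-φ₁ x))
    (he₂ : ∀ x, 0 < x → deriv (deriv φ₂) x = N₂ (φ₂ x) - Real.exp (-φ₂ x)) :
    ∀ x, 0 ≤ x → |φ₁ x - φ₂ x| ≤ η / ((1 - κ) / 2) :=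
  abs_sub_le_of_poisson (F₁ := fun s => N₁ s - Real.exp (-s))
    (F₂ := fun s => N₂ s - Real.exp (-s)) (by linarith) hη (hN.force_sub_ge hκ hδ)
    (fun s hs _ => by simpa using hNN s hs) hc₁ hc₂ hd₁ hd₂ hb₁ hb₂ h0 hl₁ hl₂ he₁ he₂

end IsIonDensity

/-- The density of the beam `g` at the potential `s`. -/
noncomputable def beamDensity (g : Velocity → ℝ) (s : ℝ) : ℝ := ∫ η, g η * speedRatio (η 0) s

namespace IsBeam

variable {a : ℝ} {g : Velocity → ℝ}

theorem integrable (hg : IsBeam a g) : Integrable g :=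
  hg.continuous.integrable_of_hasCompactSupport hg.hasCompactSupport

theorem integrable_mul_speedRatio (hg : IsBeam a g) {s : ℝ} (hs : 0 ≤ s) :
    Integrable fun η : Velocity => g η * speedRatio (η 0) s := by
  refine hg.integrable.mul_bdd (c := 1) ?_ (Eventually.of_forall fun η => ?_)
  · have : Measurable fun η : Velocity => speedRatio (η 0) s := by
      unfold speedRatio
      exact Measurable.div (by fun_prop) (by fun_prop)
    exact this.aestronglyMeasurable
  · rw [Real.norm_eq_abs, abs_of_nonneg (speedRatio_nonneg _ _)]
    exact speedRatio_le_one _ hs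

theorem le_abs_normal (hg : IsBeam a g) {η : Velocity} (hη : g η ≠ 0) : a ≤ |η 0| := by
  have := hg.normal_lt η hη
  rw [abs_of_neg (by linarith [hg.one_lt])]
  linarith

theorem mul_le_mul_of_beam (hg : IsBeam a g) {u v : Velocity → ℝ}
    (h : ∀ η, g η ≠ 0 → u η ≤ v η) (η : Velocity) : g η * u η ≤ g η * v η := by
  by_cases h0 : g η = 0
  · simp [h0]
  · exact mul_le_mul_of_nonneg_left (h η h0) (hg.nonneg η)

theorem integral_accelerated (hg : IsBeam a g) {p : ℝ} (hp : 0 ≤ p) :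
    ∫ ξ, accelerated g p ξ = beamDensity g p := by
  simpa [beamDensity] using hg.integral_accelerated_mul hp fun _ => 1

/-- The Jacobian is the inverse of the gain in normal speed, so the flux does not depend on the
potential. -/
theorem integral_normal_mul_accelerated (hg : IsBeam a g) {p : ℝ} (hp : 0 ≤ p) :
    ∫ ξ : Velocity, ξ 0 * accelerated g p ξ = ∫ η, g η * η 0 := by
  simp only [mul_comm _ (accelerated g p _)]
  rw [hg.integral_accelerated_mul hp]
  congr 1
  funext η
  by_cases h0 : g η = 0
  · simp [h0]
  have hη : η 0 < 0 := by linarith [hg.normal_lt η h0, hg.one_lt]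
  have : √(η 0 ^ 2 + 2 * p) ≠ 0 := (Real.sqrt_pos.2 (by nlinarith)).ne'
  simp only [speedRatio, accelerate, setNormal_zero, abs_of_neg hη]
  field_simp

theorem isIonDensity (hg : IsBeam a g) : IsIonDensity (1 / a ^ 2) (beamDensity g) := by
  have ha : 0 < a := one_pos.trans hg.one_lt
  refine ⟨?_, fun s t hs hst => ?_, fun s t hs hst => ?_⟩
  · rw [← hg.integral_accelerated le_rfl, hg.accelerated_zero, hg.integral_eq_one]
  · refine integral_mono (hg.integrable_mul_speedRatio (hs.trans hst))
      (hg.integrable_mul_speedRatio hs) (hg.mul_le_mul_of_beam fun η hη => ?_)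
    exact sub_nonneg.1 (speedRatio_sub_le ha (hg.le_abs_normal hη) hs hst).1
  · rw [beamDensity, beamDensity, ← integral_sub (hg.integrable_mul_speedRatio hs)
      (hg.integrable_mul_speedRatio (hs.trans hst))]
    have h1 : ∫ η, g η * (1 / a ^ 2 * (t - s)) = 1 / a ^ 2 * (t - s) := by
      rw [integral_mul_const, hg.integral_eq_one, one_mul]
    rw [← h1]
    refine integral_mono ((hg.integrable_mul_speedRatio hs).sub
      (hg.integrable_mul_speedRatio (hs.trans hst))) (hg.integrable.mul_const _) fun η => ?_
    simp only [← mul_sub]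
    exact hg.mul_le_mul_of_beam
      (fun η hη => (speedRatio_sub_le ha (hg.le_abs_normal hη) hs hst).2) η

theorem beamDensity_pos (hg : IsBeam a g) {s : ℝ} (hs : 0 ≤ s) : 0 < beamDensity g s := by
  have ha : 0 < a := one_pos.trans hg.one_lt
  refine (speedRatio_pos ha.ne' hs).trans_le ?_
  have h1 : ∫ η, g η * speedRatio a s = speedRatio a s := by
    rw [integral_mul_const, hg.integral_eq_one, one_mul]
  rw [← h1]
  refine integral_mono (hg.integrable.mul_const _) (hg.integrable_mul_speedRatio hs)
    (hg.mul_le_mul_of_beam fun η hη => ?_)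
  rw [← speedRatio_abs (η 0)]
  exact speedRatio_mono ha (hg.le_abs_normal hη) hs

theorem abs_integral_mul_sub_le (hg : IsBeam a g) {u : Velocity → ℝ} {k ε : ℝ}
    (hu : Integrable fun η => g η * u η) (h : ∀ η, g η ≠ 0 → |u η - k| ≤ ε) :
    |(∫ η, g η * u η) - k| ≤ ε := by
  have h1 : ∀ k : ℝ, ∫ η, g η * k = k := fun k => by
    rw [integral_mul_const, hg.integral_eq_one, one_mul]
  have h2 : (∫ η, g η * u η) - k = ∫ η, g η * (u η - k) := by
    conv_lhs => rw [← h1 k]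
    rw [← integral_sub hu (hg.integrable.mul_const _)]
    simp only [mul_sub]
  rw [h2]
  refine (abs_integral_le_integral_abs).trans ?_
  conv_rhs => rw [← h1 ε]
  have h3 : Integrable fun η => g η * (u η - k) := by
    simp only [mul_sub]
    exact hu.sub (hg.integrable.mul_const _)
  refine integral_mono h3.abs (hg.integrable.mul_const _) fun η => ?_
  simp only [abs_mul, abs_of_nonneg (hg.nonneg η)]
  exact hg.mul_le_mul_of_beam h η

theorem abs_beamDensity_sub_le (hg : IsBeam a g) {uinf ε s : ℝ} (hu : 1 ≤ uinf)
    (hε : ∀ η, g η ≠ 0 → |η 0 + uinf| ≤ ε) (hs : 0 ≤ s) :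
    |beamDensity g s - speedRatio uinf s| ≤ ε := by
  refine hg.abs_integral_mul_sub_le (hg.integrable_mul_speedRatio hs) fun η hη => ?_
  have h1 := hg.normal_lt η hη
  rw [← speedRatio_abs (η 0)]
  refine (abs_speedRatio_sub_le (hg.one_lt.le.trans (hg.le_abs_normal hη)) hu hs).trans ?_
  rw [abs_of_neg (show η 0 < 0 by linarith [hg.one_lt]), show -η 0 - uinf = -(η 0 + uinf) by ring, abs_neg]
  exact hε η hη

theorem abs_flux_add_le (hg : IsBeam a g) {uinf ε : ℝ}
    (hε : ∀ η, g η ≠ 0 → |η 0 + uinf| ≤ ε) : |(∫ η, g η * η 0) + uinf| ≤ ε := by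
  have hi : Integrable fun η : Velocity => g η * η 0 := by
    have := hg.integrable_mul_accelerated 0 (G := fun η => η 0) (by fun_prop)
    simpa only [hg.accelerated_zero, mul_comm] using this
  have := hg.abs_integral_mul_sub_le (u := fun η => η 0) (k := -uinf) hi fun η hη => by
    simpa using hε η hη
  simpa using this

end IsBeam

theorem normal_of_approxDelta_ne_zero {m : Velocity → ℝ} (hm : IsMollifier m) {uinf ε : ℝ}
    (hε : 0 < ε) {ξ : Velocity} (hξ : approxDelta m uinf ε ξ ≠ 0) : |ξ 0 + uinf| < ε := by
  have h1 := hm.tsupport_subset (subset_tsupport _ (right_ne_zero_of_mul hξ))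
  rw [mem_ball_zero_iff, norm_smul, Real.norm_eq_abs, abs_of_pos (by positivity),
    one_div_mul_eq_div, div_lt_one hε] at h1
  refine lt_of_le_of_lt ?_ h1
  have := abs_normal_le_norm (ξ - !₂[-uinf, 0, 0])
  simpa using this

/-- The bound on `ε` is chosen so that `-u∞ + ε < -(1 + u∞) / 2`: the whole support stays beyond the
midpoint between `1` and `u∞`. -/
theorem isBeam_approxDelta {m : Velocity → ℝ} (hm : IsMollifier m) {uinf ε : ℝ}
    (hε : 0 < ε) (hε' : ε < (uinf - 1) / 2) :
    IsBeam ((1 + uinf) / 2) (approxDelta m uinf ε) := by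
  refine ⟨?_, ?_, fun ξ => ?_, ?_, by linarith, fun ξ hξ => ?_⟩
  · have := hm.contDiff.continuous
    unfold approxDelta
    fun_prop
  · have h1 : HasCompactSupport fun ξ : Velocity => m ((1 / ε) • (ξ - !₂[-uinf, 0, 0])) :=
      hm.hasCompactSupport.comp_homeomorph ((Homeomorph.subRight (!₂[-uinf, 0, 0] : Velocity)).trans
        (Homeomorph.smulOfNeZero (1 / ε) (by positivity)))
    exact h1.mul_left
  · exact mul_nonneg (by positivity) (hm.nonneg _)
  · simp only [approxDelta, integral_const_mul]
    rw [integral_sub_right_eq_self (fun ξ : Velocity => m ((1 / ε) • ξ)),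
      Measure.integral_comp_smul, hm.integral_eq_one]
    rw [finrank_euclideanSpace_fin, abs_of_pos (by positivity)]
    simp only [smul_eq_mul]
    field_simp
  · have := abs_lt.1 (normal_of_approxDelta_ne_zero hm hε hξ)
    linarith

end

/-! ### Both boundary value problems in terms of the potential. -/

section

variable {uinf φb : ℝ} {φ : ℝ → ℝ}

theorem isEulerPoissonSolution_of_potential (hu : 0 < uinf) (hφ : ContDiff ℝ 2 φ) (h0 : φ 0 = φb)
    (hpos : ∀ x, 0 < φ x) (hd : ∀ x, deriv φ x < 0) (hle : ∀ x, 0 ≤ x → φ x ≤ φb)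
    (he : ∀ x, 0 ≤ x → deriv (deriv φ) x = speedRatio uinf (φ x) - Real.exp (-φ x))
    (hl : Tendsto φ atTop (𝓝 0)) :
    IsEulerPoissonSolution uinf φb (fun x => speedRatio uinf (φ x))
      (fun x => -√(uinf ^ 2 + 2 * φ x)) φ := by
  have hsq : ∀ x, 0 < uinf ^ 2 + 2 * φ x := fun x => by
    have := hpos x; positivity
  have hne : ∀ x, √(uinf ^ 2 + 2 * φ x) ≠ 0 := fun x => (Real.sqrt_pos.2 (hsq x)).ne'
  have hφ1 : ContDiff ℝ 1 φ := hφ.of_le (by norm_num)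
  have hu1 : ContDiff ℝ 1 fun x => √(uinf ^ 2 + 2 * φ x) :=
    ContDiff.sqrt (by fun_prop) fun x => (hsq x).ne'
  have hρ1 : ContDiff ℝ 1 fun x => speedRatio uinf (φ x) := contDiff_const.div hu1 hne
  have hρu : ∀ x, speedRatio uinf (φ x) * -√(uinf ^ 2 + 2 * φ x) = -uinf := fun x => by
    have := hne x
    rw [speedRatio, abs_of_pos hu]
    field_simp
  have hc : Continuous fun s => √(uinf ^ 2 + 2 * s) := by fun_prop
  have hlim : Tendsto (fun x => √(uinf ^ 2 + 2 * φ x)) atTop (𝓝 uinf) := by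
    have := (hc.tendsto 0).comp hl
    rw [mul_zero, add_zero, Real.sqrt_sq hu.le] at this
    exact this
  refine ⟨hρ1.continuous.continuousOn, hu1.neg.continuous.continuousOn,
    hφ.continuous.continuousOn, hρ1.contDiffOn, hu1.neg.contDiffOn, hφ.contDiffOn,
    fun x _ => ?_, fun x _ => ?_, fun x hx => he x hx.le,
    ⟨speedRatio uinf φb, speedRatio_pos hu.ne' ?_, fun x hx => ?_⟩, h0, ?_, hlim.neg, hl,
    Or.inr ((antitone_of_deriv_nonpos (hφ1.differentiable one_ne_zero)
      fun x => (hd x).le).antitoneOn _)⟩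
  · simp only [hρu, deriv_const]
  · have h1 := ((((hφ1.differentiable one_ne_zero) x).hasDerivAt.const_mul 2).const_add
      (uinf ^ 2)).sqrt (hsq x).ne'
    have := hne x
    rw [h1.fun_neg.deriv]
    field_simp
  · exact h0 ▸ (hpos 0).le
  · exact (isIonDensity_speedRatio hu le_rfl).antitone _ _ (hpos x).le (hle x hx.le)
  · have h1 := hlim.inv₀ hu.ne'
    have h2 := h1.const_mul uinf
    rw [mul_inv_cancel₀ hu.ne'] at h2
    refine h2.congr fun x => ?_
    rw [speedRatio, abs_of_pos hu, div_eq_mul_inv]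

namespace IsEulerPoissonSolution

variable {ρ u : ℝ → ℝ}

theorem potential_mem (H : IsEulerPoissonSolution uinf φb ρ u φ) (hφb : 0 < φb) :
    ∀ x, 0 ≤ x → φ x ∈ Icc 0 φb := by
  have hanti : AntitoneOn φ (Ici 0) := by
    refine H.monotone.resolve_left fun hm => ?_
    have h4 : φb ≤ 0 := by
      refine ge_of_tendsto H.tendsto_potential ?_
      filter_upwards [eventually_ge_atTop 0] with x hx
      rw [← H.boundary_potential]
      exact hm self_mem_Ici hx hx
    linarith
  refine fun x hx => ⟨le_of_tendsto H.tendsto_potential ?_, ?_⟩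
  · filter_upwards [eventually_ge_atTop x] with y hy
    exact hanti hx (hx.trans hy) hy
  · rw [← H.boundary_potential]
    exact hanti self_mem_Ici hx hx

theorem eq_of_deriv_eq_zero {v : ℝ → ℝ} {L : ℝ} (hd : DifferentiableOn ℝ v (Ioi 0))
    (h : ∀ x, 0 < x → deriv v x = 0) (hl : Tendsto v atTop (𝓝 L)) : ∀ x, 0 < x → v x = L := by
  intro x hx
  refine tendsto_nhds_unique (tendsto_const_nhds.congr' ?_) hl
  filter_upwards [eventually_gt_atTop 0] with y hy
  exact isOpen_Ioi.is_const_of_deriv_eq_zero isPreconnected_Ioi hd (fun z hz => h z hz) hx hy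

/-- `ρu` and `u² - 2φ` are constant and known at infinity. Positivity of `ρ` makes `u` negative,
which selects the root; continuity covers `x = 0`. -/
theorem eq_of_potential (H : IsEulerPoissonSolution uinf φb ρ u φ) (hu : 0 < uinf) (hφb : 0 < φb)
    {x : ℝ} (hx : 0 ≤ x) :
    ρ x = speedRatio uinf (φ x) ∧ u x = -√(uinf ^ 2 + 2 * φ x) := by
  have hρd := H.contDiffOn_density.differentiableOn one_ne_zero
  have hud := H.contDiffOn_velocity.differentiableOn one_ne_zero
  have hφd := H.contDiffOn_potential.differentiableOn two_ne_zero
  have hφ0 := fun x hx => (H.potential_mem hφb x hx).1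
  have hmass : ∀ x, 0 < x → ρ x * u x = -uinf :=
    eq_of_deriv_eq_zero (hρd.mul hud) H.mass (by
      simpa using H.tendsto_density.mul H.tendsto_velocity)
  have henergy : ∀ x, 0 < x → u x ^ 2 - 2 * φ x = uinf ^ 2 := by
    refine eq_of_deriv_eq_zero ((hud.pow 2).sub (hφd.const_mul 2)) (fun x hx => ?_) (by
      simpa using (H.tendsto_velocity.pow 2).sub (H.tendsto_potential.const_mul 2))
    have h1 := (hud.differentiableAt (Ioi_mem_nhds hx)).hasDerivAt
    have h2 := (hφd.differentiableAt (Ioi_mem_nhds hx)).hasDerivAt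
    have h3 := (h1.fun_pow 2).fun_sub (h2.const_mul 2)
    refine h3.deriv.trans ?_
    rw [← H.momentum x hx]
    push_cast
    ring
  obtain ⟨c, hc, hρc⟩ := H.density_pos
  have hu' : ∀ x, 0 < x → u x = -√(uinf ^ 2 + 2 * φ x) := fun x hx => by
    have hneg : u x < 0 := by
      have h1 := hmass x hx
      have h2 := hc.trans_le (hρc x hx)
      by_contra h3
      nlinarith [mul_nonneg h2.le (not_lt.1 h3)]
    have h1 : uinf ^ 2 + 2 * φ x = (-u x) ^ 2 := by linarith [henergy x hx]
    rw [h1, Real.sqrt_sq (by linarith), neg_neg]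
  have hρ' : ∀ x, 0 < x → ρ x = speedRatio uinf (φ x) := fun x hx => by
    have h1 := hmass x hx
    rw [hu' x hx] at h1
    have h2 : 0 < √(uinf ^ 2 + 2 * φ x) :=
      Real.sqrt_pos.2 (by have := hφ0 x hx.le; positivity)
    rw [speedRatio, abs_of_pos hu, eq_div_iff h2.ne']
    linarith
  rcases hx.eq_or_lt with rfl | hx
  · have hsqc : ContinuousOn (fun x => √(uinf ^ 2 + 2 * φ x)) (Ici 0) :=
      (continuousOn_const.add (continuousOn_const.mul H.continuousOn_potential)).sqrt
    have hrc : ContinuousOn (fun x => speedRatio uinf (φ x)) (Ici 0) :=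
      continuousOn_const.div hsqc fun x hx =>
        (Real.sqrt_pos.2 (by have := hφ0 x hx; positivity)).ne'
    have hcl : ∀ {v w : ℝ → ℝ}, ContinuousOn v (Ici 0) → ContinuousOn w (Ici 0) →
        (∀ x, 0 < x → v x = w x) → v 0 = w 0 := fun {v w} hv hw hvw => by
      have h1 := (hv 0 self_mem_Ici).mono Ioi_subset_Ici_self
      have h2 := (hw 0 self_mem_Ici).mono Ioi_subset_Ici_self
      refine tendsto_nhds_unique (h1.congr' ?_) h2
      filter_upwards [self_mem_nhdsWithin] with x hx using hvw x hx
    exact ⟨hcl H.continuousOn_density hrc hρ', hcl H.continuousOn_velocity hsqc.neg hu'⟩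
  · exact ⟨hρ' x hx, hu' x hx⟩

end IsEulerPoissonSolution

variable {a : ℝ} {g : Velocity → ℝ}

theorem IsBeam.isVlasovPoissonSolution_of_potential (hg : IsBeam a g) (hφ : ContDiff ℝ 2 φ)
    (h0 : φ 0 = φb) (hpos : ∀ x, 0 < φ x) (hd : ∀ x, deriv φ x < 0)
    (he : ∀ x, 0 ≤ x → deriv (deriv φ) x = beamDensity g (φ x) - Real.exp (-φ x))
    (hl : Tendsto φ atTop (𝓝 0)) :
    IsVlasovPoissonSolution (fun s => Real.exp (-s)) (fun _ => 0) 0 φb g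
      (fun x => accelerated g (φ x)) φ := by
  have hφ1 : ContDiff ℝ 1 φ := hφ.of_le (by norm_num)
  refine ⟨(hg.locallyIntegrable_accelerated hφ.continuous).locallyIntegrableOn _,
    fun x _ => hg.integrable_accelerated _, fun x _ => hg.tendsto_accelerated
      ((hφ.continuous.tendsto x).mono_left nhdsWithin_le_nhds), hφ1.contDiffOn, hφ.contDiffOn,
    fun x _ => Eventually.of_forall (hg.accelerated_nonneg _), Or.inr fun x hx => ?_,
    hg.weakVlasov_accelerated hφ1 hpos, ?_, fun x hx => ?_, h0, hl⟩
  · rw [dx, ((hφ1.differentiable one_ne_zero) x).derivWithin (uniqueDiffOn_Ici 0 x hx)]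
    exact hd x
  · simpa only [hg.accelerated_zero] using hg.tendsto_accelerated hl
  · rw [he x hx.le, hg.integral_accelerated (hpos x).le]

theorem IsVlasovPoissonSolution.eq_accelerated {ne : ℝ → ℝ} {f : ℝ → Velocity → ℝ}
    (H : IsVlasovPoissonSolution ne (fun _ => 0) 0 φb g f φ) (hg : IsBeam a g) (hφb : 0 < φb) :
    (∀ x, 0 ≤ x → φ x ∈ Icc 0 φb) ∧ ∀ x, 0 ≤ x → f x =ᵐ[volume] accelerated g (φ x) := by
  obtain ⟨φ', h1, h2⟩ := H.exists_isAbsorbedFlow hφb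
  refine ⟨fun x hx => ?_, fun x hx => ?_⟩
  · rw [← H.boundary_potential, h1 hx, h1 self_mem_Ici]
    exact ⟨(h2.potential_pos hx).le, h2.potential_le hx⟩
  · rw [h1 hx]
    exact h2.ae_eq_accelerated hg hx

theorem supAbs_le {v : ℝ → ℝ} {K : ℝ} (h : ∀ x, 0 < x → |v x| ≤ K) :
    supAbs v ≤ ENNReal.ofReal K :=
  iSup₂_le fun x hx => ENNReal.ofReal_le_ofReal (h x hx)

end

end PlasmaSheath

/-! ### The main theorem. -/

open PlasmaSheath in
theorem theorem2p2 (uinf : ℝ) (huinf : 1 < uinf) :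
    ∃ δ₀ : ℝ, 0 < δ₀ ∧ ∃ C₀ : ℝ, 0 < C₀ ∧
      ∀ m : PlasmaSheath.Velocity → ℝ, PlasmaSheath.IsMollifier m →
      ∀ φb : ℝ, 0 < φb → φb < δ₀ →
        -- the unique monotone solution of the Euler--Poisson problem
        ∃ ρ u φ : ℝ → ℝ,
          PlasmaSheath.IsEulerPoissonSolution uinf φb ρ u φ ∧
          (∀ ρ' u' φ' : ℝ → ℝ, PlasmaSheath.IsEulerPoissonSolution uinf φb ρ' u' φ' →
            EqOn ρ' ρ (Ici 0) ∧ EqOn u' u (Ici 0) ∧ EqOn φ' φ (Ici 0)) ∧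
          ∀ ε : ℝ, 0 < ε → ε < (uinf - 1) / 2 →
            -- the unique solution of the Vlasov--Poisson problem
            ∃ (fε : ℝ → PlasmaSheath.Velocity → ℝ) (φε : ℝ → ℝ),
              PlasmaSheath.IsVlasovPoissonSolution (fun s => Real.exp (-s)) (fun _ => 0) 0 φb
                (PlasmaSheath.approxDelta m uinf ε) fε φε ∧
              (∀ (f' : ℝ → PlasmaSheath.Velocity → ℝ) (φ' : ℝ → ℝ),
                PlasmaSheath.IsVlasovPoissonSolution (fun s => Real.exp (-s)) (fun _ => 0) 0 φb
                  (PlasmaSheath.approxDelta m uinf ε) f' φ' →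
                (∀ x, 0 ≤ x → f' x =ᵐ[volume] fε x) ∧ EqOn φ' φε (Ici 0)) ∧
              -- the moments are well defined
              (∀ x, 0 ≤ x → 0 < PlasmaSheath.density fε x ∧
                Integrable (fun ξ : PlasmaSheath.Velocity => ξ 0 * fε x ξ)) ∧
              -- the error estimate
              PlasmaSheath.supAbs (fun x => PlasmaSheath.density fε x - ρ x)
                + PlasmaSheath.supAbs (fun x =>
                    PlasmaSheath.density fε x * PlasmaSheath.meanVelocity fε x - ρ x * u x)
                + PlasmaSheath.supAbs (fun x => φε x - φ x) ≤ ENNReal.ofReal (C₀ * ε) := by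
  set a := (1 + uinf) / 2 with ha
  have ha1 : 1 < a := by rw [ha]; linarith
  have hau : a ≤ uinf := by rw [ha]; linarith
  have hu0 : 0 < uinf := one_pos.trans huinf
  set κ := 1 / a ^ 2 with hκdef
  have hκ : 0 < κ := by positivity
  have hκ1 : κ < 1 := by
    rw [hκdef, div_lt_one (by positivity)]
    exact one_lt_pow₀ ha1 two_ne_zero
  have hcpos : 0 < (1 - κ) / 2 := by linarith
  -- `δ₀` is the range on which the force is increasing. In `C₀`, the potential error `1 / ((1 - κ)
  -- / 2)` counts twice, for `φ` and through `φ` for `ρ`; the remaining `2` is one `ε` each from the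
  -- density law and the flux.
  refine ⟨-Real.log ((1 + κ) / 2), neg_pos.2 (Real.log_neg (by linarith) (by linarith)),
    2 / ((1 - κ) / 2) + 2, by positivity, fun m hm φb hφb hδ => ?_⟩
  have hN₀ : IsIonDensity κ (speedRatio uinf) := isIonDensity_speedRatio (by linarith) hau
  obtain ⟨φ, hφ, hφ0, hφpos, hφd, hφle, hφe, hφl⟩ := hN₀.exists_potential hκ hκ1 hφb hδ.le
  have hφmem : ∀ x, 0 ≤ x → φ x ∈ Icc 0 φb := fun x hx => ⟨(hφpos x).le, hφle x hx⟩
  refine ⟨fun x => speedRatio uinf (φ x), fun x => -√(uinf ^ 2 + 2 * φ x), φ,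
    isEulerPoissonSolution_of_potential hu0 hφ hφ0 hφpos hφd hφle hφe hφl,
    fun ρ' u' φ' H => ?_, fun ε hε hε' => ?_⟩
  · have hφφ : EqOn φ' φ (Ici 0) := fun x hx => by
      -- Uniqueness is the comparison estimate with identical density laws, i.e. with `η = 0`.
      have h := hN₀.abs_potential_sub_le (N₂ := speedRatio uinf) hκ hκ1 hδ.le le_rfl
        (fun s _ => by simp) hφ.continuous.continuousOn H.continuousOn_potential hφ.contDiffOn
        H.contDiffOn_potential hφmem (H.potential_mem hφb)
        (hφ0.trans H.boundary_potential.symm) hφl H.tendsto_potential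
        (fun y hy => hφe y hy.le) (fun y hy => by
          rw [H.poisson y hy, (H.eq_of_potential hu0 hφb hy.le).1]) x hx
      rw [zero_div] at h
      exact (sub_eq_zero.1 (abs_nonpos_iff.1 h)).symm
    refine ⟨fun x hx => ?_, fun x hx => ?_, hφφ⟩
    · rw [(H.eq_of_potential hu0 hφb hx).1, hφφ hx]
    · rw [(H.eq_of_potential hu0 hφb hx).2, hφφ hx]
  · have hg := isBeam_approxDelta hm hε hε'
    have hgε : ∀ η, approxDelta m uinf ε η ≠ 0 → |η 0 + uinf| ≤ ε := fun η hη =>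
      (normal_of_approxDelta_ne_zero hm hε hη).le
    set g := approxDelta m uinf ε
    have hN : IsIonDensity κ (beamDensity g) := hg.isIonDensity
    obtain ⟨φε, kφ, kφ0, kφpos, kφd, kφle, kφe, kφl⟩ := hN.exists_potential hκ hκ1 hφb hδ.le
    have kφmem : ∀ x, 0 ≤ x → φε x ∈ Icc 0 φb := fun x hx => ⟨(kφpos x).le, kφle x hx⟩
    have hden : ∀ x, density (fun x => accelerated g (φε x)) x = beamDensity g (φε x) := fun x =>
      hg.integral_accelerated (kφpos x).le
    have hdenpos : ∀ x, 0 < beamDensity g (φε x) := fun x => hg.beamDensity_pos (kφpos x).le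
    have hNN : ∀ s, 0 ≤ s → |beamDensity g s - speedRatio uinf s| ≤ ε := fun s hs =>
      hg.abs_beamDensity_sub_le huinf.le hgε hs
    have hpot : ∀ x, 0 ≤ x → |φε x - φ x| ≤ ε / ((1 - κ) / 2) :=
      hN.abs_potential_sub_le hκ hκ1 hδ.le hε.le hNN kφ.continuous.continuousOn
        hφ.continuous.continuousOn kφ.contDiffOn hφ.contDiffOn kφmem hφmem (kφ0.trans hφ0.symm)
        kφl hφl (fun y hy => kφe y hy.le) (fun y hy => hφe y hy.le)
    refine ⟨fun x => accelerated g (φε x), φε,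
      hg.isVlasovPoissonSolution_of_potential kφ kφ0 kφpos kφd kφe kφl, fun f' φ' H => ?_,
      fun x _ => ⟨by rw [hden]; exact hdenpos x,
        hg.integrable_mul_accelerated _ (by fun_prop)⟩, ?_⟩
    · obtain ⟨hmem, hf⟩ := H.eq_accelerated hg hφb
      have hφφ : EqOn φ' φε (Ici 0) := fun x hx => by
        have h := hN.abs_potential_sub_le (N₂ := beamDensity g) hκ hκ1 hδ.le le_rfl
          (fun s _ => by simp) kφ.continuous.continuousOn H.contDiffOn_one.continuousOn
          kφ.contDiffOn H.contDiffOn_two kφmem hmem (kφ0.trans H.boundary_potential.symm) kφl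
          H.tendsto_potential (fun y hy => kφe y hy.le) (fun y hy => by
            rw [H.poisson y hy, integral_congr_ae (hf y hy.le),
              hg.integral_accelerated (hmem y hy.le).1]) x hx
        rw [zero_div] at h
        exact (sub_eq_zero.1 (abs_nonpos_iff.1 h)).symm
      refine ⟨fun x hx => ?_, hφφ⟩
      simp only [← hφφ hx]
      exact hf x hx
    · have hρ : ∀ x, 0 < x → |density (fun x => accelerated g (φε x)) x - speedRatio uinf (φ x)|
          ≤ ε / ((1 - κ) / 2) + ε := fun x hx => by
        rw [hden]
        -- The density error splits at `beamDensity g (φ x)`. As `κ < 1`, changing the potential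
        -- costs at most the potential error; changing the density law costs at most `ε`.
        have hlip : ∀ s t, 0 ≤ s → s ≤ t → |beamDensity g s - beamDensity g t| ≤ |s - t| :=
          fun s t hs hst => by
            rw [abs_of_nonneg (sub_nonneg.2 (hN.antitone s t hs hst)), abs_sub_comm,
              abs_of_nonneg (sub_nonneg.2 hst)]
            have := hN.sub_le s t hs hst
            nlinarith
        have h1 : |beamDensity g (φε x) - beamDensity g (φ x)| ≤ |φε x - φ x| := by
          rcases le_total (φε x) (φ x) with h | h
          · exact hlip _ _ (kφpos x).le h
          · rw [abs_sub_comm, abs_sub_comm (φε x)]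
            exact hlip _ _ (hφpos x).le h
        exact (abs_sub_le _ (beamDensity g (φ x)) _).trans
          (add_le_add (h1.trans (hpot x hx.le)) (hNN _ (hφpos x).le))
      have hflux : ∀ x, 0 < x → |density (fun x => accelerated g (φε x)) x
          * meanVelocity (fun x => accelerated g (φε x)) x
          - speedRatio uinf (φ x) * -√(uinf ^ 2 + 2 * φ x)| ≤ ε := fun x _ => by
        have h1 : speedRatio uinf (φ x) * -√(uinf ^ 2 + 2 * φ x) = -uinf := by
          have h2 : √(uinf ^ 2 + 2 * φ x) ≠ 0 :=
            (Real.sqrt_pos.2 (by have := hφpos x; positivity)).ne'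
          rw [speedRatio, abs_of_pos hu0]
          field_simp
        have h3 := (hdenpos x).ne'
        rw [h1, meanVelocity, hg.integral_normal_mul_accelerated (kφpos x).le, hden, ← mul_assoc,
          mul_one_div_cancel h3, one_mul, sub_neg_eq_add]
        exact hg.abs_flux_add_le hgε
      refine (add_le_add (add_le_add (supAbs_le hρ) (supAbs_le hflux))
        (supAbs_le fun x hx => hpot x hx.le)).trans ?_
      have h1 : 0 ≤ ε / ((1 - κ) / 2) := by positivity
      rw [← ENNReal.ofReal_add (by positivity) hε.le, ← ENNReal.ofReal_add (by positivity) h1]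
      refine ENNReal.ofReal_le_ofReal (le_of_eq ?_)
      field_simp
      ring
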